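/- Let $V_1, V_2 \subset \mathbb{C}^n$ be bounded strictly pseudoconvex domains with $C^\infty$ boundary such that $\overline{V_2} \subset V_1$. Let $X$ be a real holomorphic vector field on an open neighbourhood $U$ of $\overline{V_1}$ (that is, a vector field given by a holomorphic map $X : U \to \mathbb{C}^n$, so that its real flow is by local biholomorphisms) which is transverse to $\partial V_1$ and to $\partial V_2$ and points into $V_1$, respectively $V_2$, there. Assume that $X$ has exactly one zero $p$ in $V_2$, and that the flow of $X$ retracts $V_1$ to $p$: for every $z \in V_1$ the integral curve of $X$ starting at $z$ exists in $U$ for all times $t \ge 0$ and tends to $p$ as $t \to +\infty$. Then $\partial V_1$ and $\partial V_2$, with the contact structures given by their complex tangent spaces $\xi_i = T\partial V_i \cap \sqrt{-1}\,T\partial V_i$, are contactomorphic: there is a $C^\infty$ diffeomorphism $\varphi : \partial V_1 \to \partial V_2$ with $d\varphi(\xi_1) = \xi_2$. -/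

import Mathlib

open Set Filter Topology
open scoped ContDiff

/-- Complex Euclidean space `ℂⁿ`; it is also a real normed space, by restriction of scalars. -/
abbrev CSpace (n : ℕ) : Type := EuclideanSpace ℂ (Fin n)

/-- `ρ` is a smooth defining function of the open set `V`: it is a `C^∞` real function on `ℂⁿ`,
`V = {ρ < 0}`, and `dρ ≠ 0` at every point of the boundary of `V`. -/
structure IsDefiningFunction {n : ℕ} (ρ : CSpace n → ℝ) (V : Set (CSpace n)) : Prop where
  contDiff : ContDiff ℝ ∞ ρ
  eq_setOf : V = {z | ρ z < 0}
  fderiv_ne_zero : ∀ z ∈ frontier V, fderiv ℝ ρ z ≠ 0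

/-- The maximal complex subspace `T ∩ iT` of the real tangent space `T = ker dρ_z` of the level
hypersurface of `ρ` through `z`. On the boundary of a strictly pseudoconvex domain with defining
function `ρ`, this field of subspaces is the contact structure. -/
def complexTangent {n : ℕ} (ρ : CSpace n → ℝ) (z : CSpace n) : Set (CSpace n) :=
  {w | fderiv ℝ ρ z w = 0 ∧ fderiv ℝ ρ z (Complex.I • w) = 0}

/-- The Levi form `∑ (∂²ρ / ∂z_j ∂z̄_k)(z) w_j w̄_k`, written through the real Hessian `H` of `ρ`
at `z` as `(H(w, w) + H(iw, iw)) / 4`. -/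
noncomputable def leviForm {n : ℕ} (ρ : CSpace n → ℝ) (z w : CSpace n) : ℝ :=
  (fderiv ℝ (fderiv ℝ ρ) z w w
    + fderiv ℝ (fderiv ℝ ρ) z (Complex.I • w) (Complex.I • w)) / 4

/-- `V` is a bounded strictly pseudoconvex domain in `ℂⁿ` with smooth boundary, and `ρ` is a smooth
defining function of it. (Strict pseudoconvexity does not depend on the choice of `ρ`.) -/
structure IsStrictlyPseudoconvexDomain {n : ℕ} (V : Set (CSpace n)) (ρ : CSpace n → ℝ) :
    Prop where
  isOpen : IsOpen V
  isConnected : IsConnected V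
  isBounded : Bornology.IsBounded V
  isDefiningFunction : IsDefiningFunction ρ V
  levi_pos : ∀ z ∈ frontier V, ∀ w ∈ complexTangent ρ z, w ≠ 0 → 0 < leviForm ρ z w

/-- The vector field `X` is transverse to the boundary of `V` (with defining function `ρ`) and
points to the inside of `V` there. -/
def PointsInward {n : ℕ} (X : CSpace n → CSpace n) (V : Set (CSpace n)) (ρ : CSpace n → ℝ) :
    Prop :=
  ∀ z ∈ frontier V, fderiv ℝ ρ z (X z) < 0

/-- The flow of the vector field `X` on `U` retracts `V` to the point `p`: the integral curve of `X`
that starts at any point of `V` exists in `U` for all times `t ≥ 0` and tends to `p` as `t → ∞`. -/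
def FlowRetracts {n : ℕ} (X : CSpace n → CSpace n) (U V : Set (CSpace n)) (p : CSpace n) : Prop :=
  ∀ z ∈ V, ∃ γ : ℝ → CSpace n, γ 0 = z ∧
    (∀ t ∈ Ici (0 : ℝ), γ t ∈ U ∧ HasDerivWithinAt γ (X (γ t)) (Ici 0) t) ∧
    Tendsto γ atTop (𝓝 p)

/-- `Φ` is smooth on the subset `S` of `ℂⁿ`, in the sense of the theory of embedded submanifolds:
it is `C^∞`, in the real sense, on an open neighbourhood of `S`. -/
def SmoothNear {n : ℕ} (Φ : CSpace n → CSpace n) (S : Set (CSpace n)) : Prop :=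
  ∃ W : Set (CSpace n), IsOpen W ∧ S ⊆ W ∧ ContDiffOn ℝ ∞ Φ W

/-- The hypersurfaces `S₁`, `S₂` of `ℂⁿ` with the fields `ξ₁`, `ξ₂` of tangent subspaces are
contactomorphic: there is a diffeomorphism `S₁ → S₂` (the restriction of `Φ`, with inverse the
restriction of `Ψ`) whose differential carries `ξ₁` onto `ξ₂` at every point. -/
def Contactomorphic {n : ℕ} (S₁ : Set (CSpace n)) (ξ₁ : CSpace n → Set (CSpace n))
    (S₂ : Set (CSpace n)) (ξ₂ : CSpace n → Set (CSpace n)) : Prop :=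
  ∃ Φ Ψ : CSpace n → CSpace n,
    SmoothNear Φ S₁ ∧ SmoothNear Ψ S₂ ∧ MapsTo Φ S₁ S₂ ∧ MapsTo Ψ S₂ S₁ ∧
    LeftInvOn Ψ Φ S₁ ∧ RightInvOn Ψ Φ S₂ ∧
    ∀ z ∈ S₁, fderiv ℝ Φ z '' ξ₁ z = ξ₂ (Φ z)

/-!
Let `φ` be the flow of `X`. Every orbit that starts in `closure V₁` enters `V₂`, and orbits cross each
boundary only once and inward; so near the compact region `closure V₁ \ V₂` the hitting times
`τ₁ ≤ τ₂` of the two boundaries are defined (`hitTime`), and the implicit function theorem makes them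
smooth. They satisfy `τᵢ ∘ φ_t = τᵢ - t`, and `τᵢ` is a defining function of `∂Vᵢ`.

The functions `Fᵢ = exp (lᵢ τᵢ)` are equal to `1` exactly on `∂Vᵢ` and decrease along `X`. For large
`lᵢ` they are strictly plurisubharmonic along `∂Vᵢ` (`IsInwardFlow.exists_leviForm_exp_pos`). This
spreads over the whole region, since `Fᵢ ∘ φ_t = exp (-lᵢ t) Fᵢ` and `φ_t` is holomorphic
(`IsInwardFlow.leviForm_exp_pos`). Both properties survive convex combinations, so the level sets
`{(1 - s) F₁ + s F₂ = 1}`, `0 ≤ s ≤ 1`, form a compact family of strictly pseudoconvex hypersurfaces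
that joins `∂V₁` to `∂V₂`: this is the point where linear interpolation, which has no meaning for the
hypersurfaces themselves, becomes possible.

Gray's stability theorem then gives the contactomorphism (`contactomorphic_levelSets`). The isotopy is
the flow of a field `(1, Y)` on `ℝ × ℂⁿ` which is determined by linear algebra from the positive
definite form `L(u, v) = B(u, v) + B(iu, iv)`, with `B` the Hessian of `(1 - s) F₁ + s F₂`
(`grayField`); Cartan's formula along the flow (`IsSmoothFlow.hasDerivAt_oneForm`) shows that complex
tangent vectors stay complex tangent.

Two general facts are developed for this. A compactly supported smooth field on a Banach space has a
smooth complete flow (`exists_isSmoothFlow`), by the implicit function theorem applied to the integral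
equation in `C([0, 1], E)`. A holomorphic map of several variables is smooth
(`contDiffOn_of_differentiableOn_complex`), by Cauchy's formula along complex lines.
-/

/-! ### Composition operators on spaces of continuous functions -/

section Nemytskii

universe u
variable {E F : Type u} [NormedAddCommGroup E] [NormedSpace ℝ E]
  [NormedAddCommGroup F] [NormedSpace ℝ F] {I : Type*} [TopologicalSpace I] [CompactSpace I]

/-- The pointwise application of a continuous family of operators to a continuous function, as a
bounded linear map in the family. -/
noncomputable def pointwiseApplyCLM : C(I, E →L[ℝ] F) →L[ℝ] C(I, E) →L[ℝ] C(I, F) :=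
  LinearMap.mkContinuous₂
    (LinearMap.mk₂ ℝ
      (fun (A : C(I, E →L[ℝ] F)) (η : C(I, E)) =>
        (⟨fun t => A t (η t), by fun_prop⟩ : C(I, F)))
      (fun A B η => by ext t; simp) (fun c A η => by ext t; simp)
      (fun A η θ => by ext t; simp) (fun c A η => by ext t; simp)) 1
    (fun A η => by
      rw [one_mul, ContinuousMap.norm_le _ (by positivity)]
      intro t
      exact (A t).le_of_opNorm_le_of_le (A.norm_coe_le_norm t) (η.norm_coe_le_norm t))

@[simp]
theorem pointwiseApplyCLM_apply (A : C(I, E →L[ℝ] F)) (η : C(I, E)) (t : I) :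
    pointwiseApplyCLM A η t = A t (η t) := rfl

/-- The derivative of `γ ↦ f ∘ γ` at `γ` is `η ↦ (t ↦ Df(γ(t)) η(t))`: the mean value inequality,
made uniform in `t` by the continuity of `γ ↦ Df ∘ γ`. -/
theorem hasFDerivAt_continuousMap_comp {f : E → F} (hf : ContDiff ℝ 1 f) (γ : C(I, E)) :
    HasFDerivAt (fun γ : C(I, E) => (⟨f, hf.continuous⟩ : C(E, F)).comp γ)
      (pointwiseApplyCLM ((⟨fderiv ℝ f, hf.continuous_fderiv one_ne_zero⟩ :
        C(E, E →L[ℝ] F)).comp γ)) γ := by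
  rw [hasFDerivAt_iff_isLittleO_nhds_zero, Asymptotics.isLittleO_iff]
  intro c hc
  set Df : C(E, E →L[ℝ] F) := ⟨fderiv ℝ f, hf.continuous_fderiv one_ne_zero⟩ with hDf
  have hcont : ContinuousAt (fun γ : C(I, E) => Df.comp γ) γ :=
    (ContinuousMap.continuous_postcomp Df).continuousAt
  obtain ⟨δ, hδ, h⟩ := (Metric.continuousAt_iff (α := C(I, E)) (β := C(I, E →L[ℝ] F))).1 hcont c hc
  filter_upwards [Metric.ball_mem_nhds (0 : C(I, E)) hδ] with η hη
  rw [mem_ball_zero_iff] at hη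
  rw [ContinuousMap.norm_le _ (by positivity)]
  intro t
  have key : ‖f (γ t + η t) - f (γ t) - fderiv ℝ f (γ t) (γ t + η t - γ t)‖
      ≤ c * ‖γ t + η t - γ t‖ := by
    refine (convex_segment (γ t) (γ t + η t)).norm_image_sub_le_of_norm_hasFDerivWithin_le'
      (f' := fderiv ℝ f)
      (fun x _ => ((hf.differentiable one_ne_zero) x).hasFDerivAt.hasFDerivWithinAt)
      ?_ (left_mem_segment _ _ _) (right_mem_segment _ _ _)
    intro x hx
    rw [segment_eq_image'] at hx
    obtain ⟨s, hs, rfl⟩ := hx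
    have hd : dist (γ + s • η) γ < δ := by
      rw [dist_eq_norm, add_sub_cancel_left, norm_smul, Real.norm_of_nonneg hs.1]
      exact lt_of_le_of_lt (mul_le_of_le_one_left (norm_nonneg _) hs.2) hη
    have h2 := (ContinuousMap.dist_lt_iff hc).1 (h hd) t
    rw [dist_eq_norm] at h2
    simpa [hDf] using h2.le
  rw [add_sub_cancel_left] at key
  refine le_trans ?_ (le_trans key (mul_le_mul_of_nonneg_left (η.norm_coe_le_norm t) hc.le))
  simp [hDf]

/-- Composition with a smooth map is a smooth operator on continuous functions. -/
theorem contDiff_continuousMap_comp {f : E → F} {n : ℕ} (hf : ContDiff ℝ n f) :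
    ContDiff ℝ n (fun γ : C(I, E) => (⟨f, hf.continuous⟩ : C(E, F)).comp γ) := by
  induction n generalizing F with
  | zero =>
    simp only [Nat.cast_zero, contDiff_zero]
    exact ContinuousMap.continuous_postcomp _
  | succ n ih =>
    have h1 : ContDiff ℝ 1 f := hf.of_le (by exact_mod_cast Nat.le_add_left 1 n)
    have hd : ContDiff ℝ n (fderiv ℝ f) :=
      hf.fderiv_right (by norm_cast)
    have hsucc := contDiff_succ_iff_fderiv (𝕜 := ℝ) (n := (n : WithTop ℕ∞))
      (f := fun γ : C(I, E) => (⟨f, hf.continuous⟩ : C(E, F)).comp γ)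
    refine hsucc.2 ?_
    refine ⟨fun γ => (hasFDerivAt_continuousMap_comp h1 γ).differentiableAt, by simp, ?_⟩
    have : fderiv ℝ (fun γ : C(I, E) => (⟨f, hf.continuous⟩ : C(E, F)).comp γ)
        = fun γ => pointwiseApplyCLM ((⟨fderiv ℝ f, hd.continuous⟩ :
          C(E, E →L[ℝ] F)).comp γ) :=
      funext fun γ => (hasFDerivAt_continuousMap_comp h1 γ).fderiv
    rw [this]
    exact pointwiseApplyCLM.contDiff.comp (ih hd)

theorem contDiff_infty_continuousMap_comp {f : E → F} (hf : ContDiff ℝ ∞ f) :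
    ContDiff ℝ ∞ (fun γ : C(I, E) => (⟨f, hf.continuous⟩ : C(E, F)).comp γ) :=
  contDiff_infty.2 fun n => contDiff_continuousMap_comp (contDiff_infty.1 hf n)

end Nemytskii

/-! ### Smooth flows of compactly supported vector fields -/

section Flow

universe u
variable {E : Type u} [NormedAddCommGroup E] [NormedSpace ℝ E]

/-- The primitive `s ↦ ∫₀ˢ η`, as a bounded operator on continuous functions on `[0, 1]`. -/
noncomputable def primitiveCLM : C(unitInterval, E) →L[ℝ] C(unitInterval, E) :=
  LinearMap.mkContinuous
    { toFun := fun η => ⟨fun s => ∫ u in (0 : ℝ)..s, IccExtend zero_le_one η u,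
        (intervalIntegral.continuous_primitive
          (fun a b => (η.continuous.Icc_extend').intervalIntegrable a b) 0).comp
          continuous_subtype_val⟩
      map_add' := fun η θ => by
        ext s
        simp only [ContinuousMap.coe_mk, ContinuousMap.add_apply]
        rw [← intervalIntegral.integral_add
          ((η.continuous.Icc_extend').intervalIntegrable _ _)
          ((θ.continuous.Icc_extend').intervalIntegrable _ _)]
        rfl
      map_smul' := fun c η => by
        ext s
        simp only [ContinuousMap.coe_mk, ContinuousMap.smul_apply, RingHom.id_apply]
        rw [← intervalIntegral.integral_smul]
        rfl } 1
    (fun η => by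
      rw [one_mul, ContinuousMap.norm_le _ (norm_nonneg _)]
      intro s
      refine (intervalIntegral.norm_integral_le_of_norm_le_const (C := ‖η‖) fun u _ =>
        η.norm_coe_le_norm _).trans ?_
      rw [sub_zero, abs_of_nonneg s.2.1]
      exact mul_le_of_le_one_right (norm_nonneg _) s.2.2)

theorem primitiveCLM_apply (η : C(unitInterval, E)) (s : unitInterval) :
    primitiveCLM η s = ∫ u in (0 : ℝ)..s, IccExtend zero_le_one η u := rfl

theorem norm_primitiveCLM_le : ‖(primitiveCLM : C(unitInterval, E) →L[ℝ] _)‖ ≤ 1 :=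
  LinearMap.mkContinuous_norm_le _ zero_le_one _

/-- `φ` is the flow of the vector field `V`: it is defined for all times, jointly smooth in time and
space, satisfies the group law, and its orbits are the integral curves of `V`. -/
structure IsSmoothFlow (V : E → E) (φ : ℝ → E → E) : Prop where
  contDiff : ContDiff ℝ ∞ (fun q : ℝ × E => φ q.1 q.2)
  zero : ∀ x, φ 0 x = x
  add : ∀ s t x, φ (s + t) x = φ s (φ t x)
  hasDerivAt : ∀ t x, HasDerivAt (fun t => φ t x) (V (φ t x)) t

/-- A bounded Lipschitz vector field has complete integral curves. -/
theorem exists_integralCurve [CompleteSpace E] {V : E → E} {K : NNReal} (hK : LipschitzWith K V)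
    {M : NNReal} (hM : ∀ x, ‖V x‖ ≤ M) (x : E) :
    ∃ γ : ℝ → E, γ 0 = x ∧ ∀ t, HasDerivAt γ (V (γ t)) t := by
  have hloc : ∀ T : NNReal, ∃ α : ℝ → E, α 0 = x ∧
      ∀ t ∈ Ioo (-(T : ℝ)) T, HasDerivAt α (V (α t)) t := by
    intro T
    let t₀ : Icc (-(T : ℝ)) T := ⟨0, by simp, T.2⟩
    have hpl : IsPicardLindelof (fun _ => V) t₀ x (M * T) 0 M K :=
      IsPicardLindelof.of_time_independent (fun y _ => hM y) hK.lipschitzOnWith (by simp [t₀])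
    obtain ⟨α, h0, hα⟩ := hpl.exists_eq_forall_mem_Icc_hasDerivWithinAt₀
    exact ⟨α, h0, fun t ht => (hα t (Ioo_subset_Icc_self ht)).hasDerivAt
      (Icc_mem_nhds ht.1 ht.2)⟩
  choose α h0 hα using hloc
  have huniq : ∀ S T : NNReal, S ≤ T → ∀ t ∈ Ioo (-(S : ℝ)) S, α S t = α T t := by
    intro S T hST t ht
    have hS : (0 : ℝ) ∈ Ioo (-(S : ℝ)) S := by constructor <;> linarith [ht.1, ht.2]
    have hST' : (S : ℝ) ≤ T := hST
    exact ODE_solution_unique_of_mem_Ioo (v := fun _ => V) (s := fun _ => univ) (K := K)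
      (fun _ _ => hK.lipschitzOnWith) hS
      (fun t ht => ⟨hα S t ht, trivial⟩)
      (fun t ht => ⟨hα T t ⟨by linarith [ht.1], by linarith [ht.2]⟩, trivial⟩)
      ((h0 S).trans (h0 T).symm) ht
  refine ⟨fun t => α (‖t‖₊ + 1) t, h0 _, fun t => ?_⟩
  have ht : t ∈ Ioo (-((‖t‖₊ + 2 : NNReal) : ℝ)) (‖t‖₊ + 2 : NNReal) := by
    push_cast
    rw [Real.norm_eq_abs]
    constructor <;> linarith [neg_abs_le t, le_abs_self t]
  have hev : (fun s => α (‖s‖₊ + 1) s) =ᶠ[𝓝 t] α (‖t‖₊ + 2) := by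
    have : ∀ᶠ s in 𝓝 t, ‖s‖₊ < ‖t‖₊ + 1 :=
      (continuous_nnnorm.tendsto t).eventually (gt_mem_nhds (by simp))
    filter_upwards [this] with s hs
    refine huniq _ _ ?_ s ?_
    · calc ‖s‖₊ + 1 ≤ ‖t‖₊ + 1 + 1 := by gcongr
        _ = ‖t‖₊ + 2 := by ring
    · push_cast
      rw [Real.norm_eq_abs]
      constructor <;> linarith [neg_abs_le s, le_abs_self s]
  have heq : α (‖t‖₊ + 1) t = α (‖t‖₊ + 2) t := hev.eq_of_nhds
  simp only [heq]
  exact (hα _ t ht).congr_of_eventuallyEq hev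

theorem isInvertible_one_sub {X : Type*} [NormedAddCommGroup X] [NormedSpace ℝ X]
    [CompleteSpace X] {A : X →L[ℝ] X} (hA : ‖A‖ < 1) :
    ((1 : X →L[ℝ] X) - A).IsInvertible := by
  obtain ⟨e, he⟩ := isUnit_one_sub_of_norm_lt_one hA
  exact ⟨ContinuousLinearEquiv.ofUnit e, by rw [← he]; rfl⟩

/-- For `|h| L < 1` the integral equation `γ = x + h ∫ V ∘ γ` on `[0, 1]` has a unique solution,
which depends smoothly on `(h, x)`: the implicit function theorem in `C([0, 1], E)`, where the
linearized operator is a small perturbation of the identity. -/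
theorem contDiffAt_of_integral_equation [CompleteSpace E] {V : E → E} (hV : ContDiff ℝ ∞ V)
    {L : NNReal} (hL : LipschitzWith L V) {Γ : ℝ × E → C(unitInterval, E)}
    (hΓ : ∀ q : ℝ × E, Γ q = ContinuousMap.const _ q.2
      + q.1 • primitiveCLM ((⟨V, hV.continuous⟩ : C(E, E)).comp (Γ q)))
    (q₀ : ℝ × E) (hq₀ : |q₀.1| * L < 1) : ContDiffAt ℝ ∞ Γ q₀ := by
  set N : C(unitInterval, E) → C(unitInterval, E) :=
    fun γ => (⟨V, hV.continuous⟩ : C(E, E)).comp γ with hN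
  have hNsmooth : ContDiff ℝ ∞ N := contDiff_infty_continuousMap_comp hV
  have hNlip : LipschitzWith L N := by
    refine LipschitzWith.of_dist_le_mul fun γ θ => ?_
    rw [ContinuousMap.dist_le (by positivity)]
    exact fun t => (hL.dist_le_mul _ _).trans
      (mul_le_mul_of_nonneg_left (ContinuousMap.dist_apply_le_dist t) L.2)
  set G : (ℝ × E) × C(unitInterval, E) → C(unitInterval, E) := fun w =>
    w.2 - ContinuousLinearMap.const ℝ unitInterval w.1.2 - w.1.1 • primitiveCLM (N w.2) with hG
  have hGsmooth : ContDiff ℝ ∞ G := by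
    have h1 : ContDiff ℝ ∞ fun w : (ℝ × E) × C(unitInterval, E) => N w.2 :=
      hNsmooth.comp contDiff_snd
    have h2 : ContDiff ℝ ∞ fun w : (ℝ × E) × C(unitInterval, E) => primitiveCLM (N w.2) :=
      (primitiveCLM (E := E)).contDiff.comp h1
    have h3 : ContDiff ℝ ∞ fun w : (ℝ × E) × C(unitInterval, E) =>
        ContinuousLinearMap.const ℝ unitInterval w.1.2 :=
      (ContinuousLinearMap.const ℝ unitInterval : E →L[ℝ] _).contDiff.comp
        (contDiff_snd.comp contDiff_fst)
    exact (contDiff_snd.sub h3).sub ((contDiff_fst.comp contDiff_fst).smul h2)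
  have hGΓ : ∀ q, G (q, Γ q) = 0 := by
    intro q
    simp only [hG]
    nth_rw 1 [hΓ q]
    simp only [hN]
    have : ContinuousLinearMap.const ℝ unitInterval q.2 = ContinuousMap.const unitInterval q.2 :=
      rfl
    rw [this]
    abel
  have hD : fderiv ℝ G (q₀, Γ q₀) ∘L .inr ℝ (ℝ × E) C(unitInterval, E)
      = 1 - q₀.1 • (primitiveCLM ∘L fderiv ℝ N (Γ q₀)) := by
    have h1 : HasFDerivAt (fun γ => G (q₀, γ))
        (fderiv ℝ G (q₀, Γ q₀) ∘L .inr ℝ (ℝ × E) C(unitInterval, E)) (Γ q₀) :=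
      (((hGsmooth.differentiable (by simp)) (q₀, Γ q₀)).hasFDerivAt).comp (Γ q₀)
        (hasFDerivAt_prodMk_right q₀ (Γ q₀))
    have h2 : HasFDerivAt (fun γ => G (q₀, γ))
        (1 - q₀.1 • (primitiveCLM ∘L fderiv ℝ N (Γ q₀))) (Γ q₀) := by
      have h3 : HasFDerivAt N (fderiv ℝ N (Γ q₀)) (Γ q₀) :=
        ((hNsmooth.differentiable (by simp)) _).hasFDerivAt
      exact ((hasFDerivAt_id (𝕜 := ℝ) (Γ q₀)).sub_const
        (ContinuousLinearMap.const ℝ unitInterval q₀.2)).sub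
        (((primitiveCLM (E := E)).hasFDerivAt.comp (Γ q₀) h3).const_smul q₀.1)
    exact h1.unique h2
  have hinv : (fderiv ℝ G (q₀, Γ q₀) ∘L .inr ℝ (ℝ × E) C(unitInterval, E)).IsInvertible := by
    rw [hD]
    have hnorm : ‖q₀.1 • (primitiveCLM ∘L fderiv ℝ N (Γ q₀))‖ < 1 := by
      refine lt_of_le_of_lt (ContinuousLinearMap.opNorm_smul_le _ _) ?_
      rw [Real.norm_eq_abs]
      refine lt_of_le_of_lt (mul_le_mul_of_nonneg_left ?_ (abs_nonneg _)) hq₀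
      refine (ContinuousLinearMap.opNorm_comp_le _ _).trans ?_
      calc _ ≤ 1 * (L : ℝ) := mul_le_mul norm_primitiveCLM_le
            (norm_fderiv_le_of_lipschitz ℝ hNlip) (norm_nonneg _) zero_le_one
        _ = L := one_mul _
    exact isInvertible_one_sub (X := C(unitInterval, E)) hnorm
  have hcd : ContDiffAt ℝ ∞ G (q₀, Γ q₀) := hGsmooth.contDiffAt
  have hpn : (∞ : WithTop ℕ∞) ≠ 0 := by simp
  refine (hcd.contDiffAt_implicitFunction hpn hinv).congr_of_eventuallyEq ?_
  have h1 := hcd.eventually_apply_implicitFunction hpn hinv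
  have h2 : ∀ᶠ q : ℝ × E in 𝓝 q₀, |q.1| * L < 1 :=
    (show Continuous fun q : ℝ × E => |q.1| * (L : ℝ) by fun_prop).continuousAt.eventually
      (gt_mem_nhds hq₀)
  filter_upwards [h1, h2] with q hq1 hq2
  set θ := hcd.implicitFunction hpn hinv q
  rw [hGΓ] at hq1
  have hq3 := hGΓ q
  simp only [hG] at hq1 hq3
  have hdiff : Γ q - θ = q.1 • primitiveCLM (N (Γ q) - N θ) := by
    rw [map_sub, smul_sub]
    have e1 := sub_eq_zero.1 hq1
    have e2 := sub_eq_zero.1 hq3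
    rw [← e1, ← e2]
    abel
  have hle : ‖Γ q - θ‖ ≤ |q.1| * L * ‖Γ q - θ‖ := by
    calc ‖Γ q - θ‖ = ‖q.1 • primitiveCLM (N (Γ q) - N θ)‖ := by rw [← hdiff]
      _ ≤ |q.1| * (1 * (L * ‖Γ q - θ‖)) := by
        rw [norm_smul, Real.norm_eq_abs]
        gcongr
        refine (ContinuousLinearMap.le_of_opNorm_le _ norm_primitiveCLM_le _).trans ?_
        gcongr
        simpa [dist_eq_norm] using hNlip.dist_le_mul (Γ q) θ
      _ = _ := by ring
  have : ‖Γ q - θ‖ = 0 := by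
    by_contra hne
    have hpos : 0 < ‖Γ q - θ‖ := lt_of_le_of_ne (norm_nonneg _) (Ne.symm hne)
    nlinarith
  exact sub_eq_zero.1 (norm_eq_zero.1 this)

/-- A compactly supported smooth vector field has a smooth flow. For small times it is given by the
integral equation on `[0, 1]`; the group law propagates smoothness to all times. -/
theorem exists_isSmoothFlow [CompleteSpace E] {V : E → E} (hV : ContDiff ℝ ∞ V)
    (hc : HasCompactSupport V) : ∃ φ, IsSmoothFlow V φ := by
  obtain ⟨L, hL⟩ := hV.lipschitzWith_of_hasCompactSupport hc (by simp)
  obtain ⟨M, hM⟩ := hc.exists_bound_of_continuous hV.continuous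
  have hM' : ∀ x, ‖V x‖ ≤ (Real.toNNReal M : ℝ) := fun x => (hM x).trans (Real.le_coe_toNNReal M)
  choose φ h0 hφ using fun x => exists_integralCurve hL hM' x
  have huniq : ∀ {γ θ : ℝ → E}, (∀ t, HasDerivAt γ (V (γ t)) t) →
      (∀ t, HasDerivAt θ (V (θ t)) t) → γ 0 = θ 0 → γ = θ := fun hγ hθ h =>
    ODE_solution_unique_univ (v := fun _ => V) (s := fun _ => univ) (K := L)
      (fun _ => hL.lipschitzOnWith) (fun t => ⟨hγ t, trivial⟩) (fun t => ⟨hθ t, trivial⟩) h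
  have hadd : ∀ s t x, φ x (s + t) = φ (φ x t) s := by
    intro s t x
    refine congrFun (huniq (γ := fun s => φ x (s + t)) (θ := φ (φ x t)) (fun s => ?_) (hφ _) ?_) s
    · exact (hφ x (s + t)).comp_add_const s t
    · simp [h0]
  have hcont : ∀ x, Continuous (φ x) := fun x =>
    continuous_iff_continuousAt.2 fun t => (hφ x t).continuousAt
  set Γ : ℝ × E → C(unitInterval, E) := fun q =>
    ⟨fun s => φ q.2 (q.1 * s), (hcont q.2).comp (by fun_prop)⟩ with hΓdef
  have hΓ : ∀ q : ℝ × E, Γ q = ContinuousMap.const _ q.2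
      + q.1 • primitiveCLM ((⟨V, hV.continuous⟩ : C(E, E)).comp (Γ q)) := by
    intro q
    ext s
    have hd : ∀ u ∈ uIcc (0 : ℝ) s, HasDerivAt (fun u => φ q.2 (q.1 * u))
        (q.1 • V (φ q.2 (q.1 * u))) u := by
      intro u _
      have := (hφ q.2 (q.1 * u)).scomp u ((hasDerivAt_id u).const_mul q.1)
      simpa [Function.comp_def] using this
    have hint := intervalIntegral.integral_eq_sub_of_hasDerivAt hd
      (Continuous.intervalIntegrable (by
        have := hV.continuous
        have := hcont q.2
        fun_prop) _ _)
    rw [intervalIntegral.integral_smul] at hint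
    simp only [ContinuousMap.add_apply, ContinuousMap.smul_apply, ContinuousMap.const_apply,
      primitiveCLM_apply]
    have hcongr : ∫ u in (0 : ℝ)..s, IccExtend zero_le_one
        ((⟨V, hV.continuous⟩ : C(E, E)).comp (Γ q)) u
        = ∫ u in (0 : ℝ)..s, V (φ q.2 (q.1 * u)) := by
      refine intervalIntegral.integral_congr fun u hu => ?_
      rw [uIcc_of_le s.2.1] at hu
      rw [IccExtend_of_mem _ _ ⟨hu.1, hu.2.trans s.2.2⟩]
      rfl
    rw [hcongr, hint]
    simp [hΓdef, h0]
  have hsmall : ∀ q : ℝ × E, |q.1| * L < 1 → ContDiffAt ℝ ∞ (fun q : ℝ × E => φ q.2 q.1) q := by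
    intro q hq
    have h1 := contDiffAt_of_integral_equation hV hL hΓ q hq
    have h2 : (fun q : ℝ × E => φ q.2 q.1)
        = fun q => ContinuousMap.evalCLM ℝ (1 : unitInterval) (Γ q) := by
      ext q
      simp [hΓdef]
    rw [h2]
    exact (ContinuousMap.evalCLM ℝ (1 : unitInterval)).contDiff.contDiffAt.comp q h1
  have hslice : ∀ t : ℝ, |t| * L < 1 → ContDiff ℝ ∞ fun x => φ x t := fun t ht =>
    contDiff_iff_contDiffAt.2 fun x =>
      (hsmall (t, x) ht).comp x (contDiffAt_const.prodMk contDiffAt_id)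
  have hslice_nat : ∀ (n : ℕ) (t : ℝ), |t| * L < 1 → ContDiff ℝ ∞ fun x => φ x (n * t) := by
    intro n t ht
    induction n with
    | zero => simpa [h0] using contDiff_fun_id
    | succ n ih =>
      have : (fun x => φ x ((n + 1 : ℕ) * t)) = fun x => φ (φ x (n * t)) t := by
        ext x
        rw [← hadd]
        push_cast
        ring_nf
      rw [this]
      exact (hslice t ht).comp ih
  have hslice_all : ∀ t : ℝ, ContDiff ℝ ∞ fun x => φ x t := by
    intro t
    obtain ⟨n, hn⟩ := exists_nat_gt (|t| * L)
    have hn0 : (0 : ℝ) < n := lt_of_le_of_lt (by positivity) hn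
    have := hslice_nat n (t / n) (by
      rw [abs_div, Nat.abs_cast, div_mul_eq_mul_div, div_lt_one hn0]
      exact hn)
    rwa [mul_div_cancel₀ _ hn0.ne'] at this
  refine ⟨fun t x => φ x t, ?_, h0, hadd, fun t x => hφ x t⟩
  refine contDiff_iff_contDiffAt.2 fun q => ?_
  have hq : (fun r : ℝ × E => φ r.2 r.1) = fun r => φ (φ r.2 q.1) (r.1 - q.1) := by
    ext r
    rw [← hadd]
    ring_nf
  change ContDiffAt ℝ ∞ (fun r : ℝ × E => φ r.2 r.1) q
  rw [hq]
  have hin : ContDiff ℝ ∞ fun r : ℝ × E => (r.1 - q.1, φ r.2 q.1) :=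
    (contDiff_fst.sub contDiff_const).prodMk ((hslice_all q.1).comp contDiff_snd)
  exact (hsmall ((q.1 - q.1, φ q.2 q.1) : ℝ × E) (by simp)).comp q hin.contDiffAt

end Flow

/-! ### Smoothness of holomorphic maps of several variables -/

section Holomorphic

open Metric MeasureTheory

variable {E F : Type*} [NormedAddCommGroup E] [NormedSpace ℂ E]
  [NormedAddCommGroup F] [NormedSpace ℂ F]

/-- Cauchy's estimate along complex lines. -/
theorem norm_fderiv_le_of_differentiableOn_ball [CompleteSpace F] {f : E → F} {y : E}
    {R M : ℝ} (hR : 0 < R)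
    (hf : DifferentiableOn ℂ f (ball y R)) (hM : ∀ z ∈ ball y R, ‖f z‖ ≤ M) :
    ‖fderiv ℂ f y‖ ≤ M / (R / 2) := by
  have hM0 : 0 ≤ M := (norm_nonneg _).trans (hM y (mem_ball_self hR))
  refine ContinuousLinearMap.opNorm_le_bound _ (by positivity) fun v => ?_
  by_cases hv : v = 0
  · simp [hv]
  have hv' : 0 < ‖v‖ := norm_pos_iff.2 hv
  set r := R / 2 / ‖v‖ with hr
  have hr0 : 0 < r := by positivity
  have hmem : ∀ ζ ∈ closedBall (0 : ℂ) r, y + ζ • v ∈ ball y R := by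
    intro ζ hζ
    rw [mem_closedBall_zero_iff] at hζ
    rw [mem_ball_iff_norm, add_sub_cancel_left, norm_smul]
    calc ‖ζ‖ * ‖v‖ ≤ r * ‖v‖ := by gcongr
      _ = R / 2 := by rw [hr]; field_simp
      _ < R := by linarith
  have hline : ∀ ζ : ℂ, HasDerivAt (fun ζ : ℂ => y + ζ • v) v ζ := fun ζ => by
    simpa using ((hasDerivAt_id ζ).smul_const v).const_add y
  have hcomp : ∀ ζ ∈ closedBall (0 : ℂ) r,
      HasDerivAt (fun ζ : ℂ => f (y + ζ • v)) (fderiv ℂ f (y + ζ • v) v) ζ := fun ζ hζ =>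
    ((hf.differentiableAt (isOpen_ball.mem_nhds (hmem ζ hζ))).hasFDerivAt).comp_hasDerivAt ζ
      (hline ζ)
  have hd : DiffContOnCl ℂ (fun ζ : ℂ => f (y + ζ • v)) (ball 0 r) :=
    DifferentiableOn.diffContOnCl (by
      rw [closure_ball _ hr0.ne']
      exact fun ζ hζ => (hcomp ζ hζ).differentiableAt.differentiableWithinAt)
  have h := Complex.norm_deriv_le_of_forall_mem_sphere_norm_le hr0 hd
    (fun ζ hζ => hM _ (hmem ζ (sphere_subset_closedBall hζ)))
  rw [(hcomp 0 (mem_closedBall_self hr0.le)).deriv, zero_smul, add_zero] at h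
  refine h.trans (le_of_eq ?_)
  rw [hr]
  field_simp

/-- A directional derivative of a holomorphic map is holomorphic: differentiate Cauchy's formula
along complex lines under the integral sign. -/
theorem differentiableOn_fderiv_apply [FiniteDimensional ℂ E] [FiniteDimensional ℂ F] {f : E → F}
    {U : Set E} (hU : IsOpen U) (hf : DifferentiableOn ℂ f U) (w : E) :
    DifferentiableOn ℂ (fun z => fderiv ℂ f z w) U := by
  let _ : MeasurableSpace E := borel E
  have : BorelSpace E := ⟨rfl⟩
  let _ : MeasurableSpace (E →L[ℂ] F) := borel _
  have : BorelSpace (E →L[ℂ] F) := ⟨rfl⟩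
  have : CompleteSpace F := FiniteDimensional.complete ℂ F
  have : ProperSpace E := FiniteDimensional.proper ℂ E
  intro z₀ hz₀
  obtain ⟨R, hR, hRU⟩ := nhds_basis_closedBall.mem_iff.1 (hU.mem_nhds hz₀)
  obtain ⟨M, hM⟩ := (isCompact_closedBall z₀ R).exists_bound_of_continuousOn
    (hf.continuousOn.mono hRU)
  have hB : ∀ y ∈ ball z₀ (R / 2), ‖fderiv ℂ f y‖ ≤ M / (R / 2 / 2) := by
    intro y hy
    have hsub : ball y (R / 2) ⊆ closedBall z₀ R := by
      refine (ball_subset_ball' ?_).trans ball_subset_closedBall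
      linarith [mem_ball.1 hy]
    exact norm_fderiv_le_of_differentiableOn_ball (half_pos hR) (hf.mono (hsub.trans hRU))
      fun z hz => hM z (hsub hz)
  set r := R / 4 / (‖w‖ + 1) with hr
  have hr0 : 0 < r := by positivity
  have hrw : r * ‖w‖ < R / 4 := by
    rw [hr, div_mul_eq_mul_div, div_lt_iff₀ (by positivity)]
    nlinarith [norm_nonneg w]
  have hmem : ∀ z ∈ ball z₀ (R / 4), ∀ ζ ∈ closedBall (0 : ℂ) r, z + ζ • w ∈ ball z₀ (R / 2) := by
    intro z hz ζ hζ
    rw [mem_closedBall_zero_iff] at hζ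
    rw [mem_ball_iff_norm] at hz ⊢
    calc ‖z + ζ • w - z₀‖ = ‖(z - z₀) + ζ • w‖ := by congr 1; abel
      _ ≤ ‖z - z₀‖ + ‖ζ • w‖ := norm_add_le _ _
      _ ≤ ‖z - z₀‖ + r * ‖w‖ := by rw [norm_smul]; gcongr
      _ < R / 2 := by linarith
  have hsubU : ball z₀ (R / 2) ⊆ U :=
    (ball_subset_closedBall.trans (closedBall_subset_closedBall (by linarith))).trans hRU
  set c : ℝ → ℂ := fun θ => deriv (circleMap 0 r) θ • ((circleMap 0 r θ - 0) ^ 2)⁻¹ with hc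
  have hc_cont : Continuous c := by
    have h1 : ∀ θ, (circleMap 0 r θ - 0) ^ 2 ≠ 0 := fun θ => by
      simp [hr0.ne']
    have h2 : Continuous (deriv (circleMap 0 r)) := by
      have : deriv (circleMap 0 r) = fun θ => circleMap 0 r θ * Complex.I :=
        funext fun θ => deriv_circleMap 0 r θ
      rw [this]
      fun_prop
    exact h2.smul (Continuous.inv₀ (by fun_prop) h1)
  have hcirc : ∀ θ, circleMap 0 r θ ∈ closedBall (0 : ℂ) r := fun θ =>
    circleMap_mem_closedBall 0 hr0.le θ
  have hdiff : ∀ θ, ∀ z ∈ ball z₀ (R / 4), DifferentiableAt ℂ f (z + circleMap 0 r θ • w) :=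
    fun θ z hz => hf.differentiableAt (hU.mem_nhds (hsubU (hmem z hz _ (hcirc θ))))
  have hFcont : ∀ z ∈ ball z₀ (R / 4),
      Continuous fun θ => c θ • f (z + circleMap 0 r θ • w) := by
    intro z hz
    refine hc_cont.smul (continuous_iff_continuousAt.2 fun θ => ?_)
    have h1 : ContinuousAt (fun θ => z + circleMap 0 r θ • w) θ := by fun_prop
    exact ContinuousAt.comp (f := fun θ => z + circleMap 0 r θ • w) (hdiff θ z hz).continuousAt h1
  have hball : ball z₀ (R / 4) ∈ 𝓝 z₀ := ball_mem_nhds _ (by positivity)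
  have hz₀' : z₀ ∈ ball z₀ (R / 4) := mem_of_mem_nhds hball
  have hint := intervalIntegral.hasFDerivAt_integral_of_dominated_of_fderiv_le (𝕜 := ℂ)
    (μ := volume) (a := 0) (b := 2 * Real.pi) (x₀ := z₀)
    (F := fun z θ => c θ • f (z + circleMap 0 r θ • w))
    (F' := fun z θ => c θ • fderiv ℂ f (z + circleMap 0 r θ • w))
    (bound := fun θ => ‖c θ‖ * (M / (R / 2 / 2))) hball
    (by
      filter_upwards [hball] with z hz
      exact (hFcont z hz).aestronglyMeasurable)
    ((hFcont z₀ hz₀').intervalIntegrable _ _)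
    (by
      have h1 : Measurable fun θ : ℝ => fderiv ℂ f (z₀ + circleMap 0 r θ • w) :=
        (measurable_fderiv ℂ f).comp
          (show Continuous fun θ : ℝ => z₀ + circleMap 0 r θ • w by fun_prop).measurable
      exact hc_cont.aestronglyMeasurable.smul h1.aestronglyMeasurable)
    (Eventually.of_forall fun θ _ z hz => by
      rw [norm_smul]
      exact mul_le_mul_of_nonneg_left (hB _ (hmem z hz _ (hcirc θ))) (norm_nonneg _))
    ((by fun_prop : Continuous fun θ => ‖c θ‖ * (M / (R / 2 / 2))).intervalIntegrable _ _)
    (Eventually.of_forall fun θ _ z hz => by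
      have h2 := ((hdiff θ z hz).hasFDerivAt.comp z
        ((hasFDerivAt_id z).add_const (circleMap 0 r θ • w))).const_smul (c θ)
      exact h2)
  have hcauchy : ∀ᶠ z in 𝓝 z₀, fderiv ℂ f z w = (2 * Real.pi * Complex.I : ℂ)⁻¹ •
      ∫ θ in (0 : ℝ)..2 * Real.pi, c θ • f (z + circleMap 0 r θ • w) := by
    filter_upwards [hball] with z hz
    have hline : ∀ ζ : ℂ, HasDerivAt (fun ζ : ℂ => z + ζ • w) w ζ := fun ζ => by
      simpa using ((hasDerivAt_id ζ).smul_const w).const_add z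
    have hUl : IsOpen ((fun ζ : ℂ => z + ζ • w) ⁻¹' U) := hU.preimage (by fun_prop)
    have hdl : ∀ ζ ∈ (fun ζ : ℂ => z + ζ • w) ⁻¹' U,
        HasDerivAt (fun ζ : ℂ => f (z + ζ • w)) (fderiv ℂ f (z + ζ • w) w) ζ := fun ζ hζ =>
      ((hf.differentiableAt (hU.mem_nhds hζ)).hasFDerivAt).comp_hasDerivAt ζ (hline ζ)
    have h := Complex.two_pi_I_inv_smul_circleIntegral_sub_sq_inv_smul_of_differentiable hUl
      (c := 0) (w₀ := 0) (R := r) (f := fun ζ : ℂ => f (z + ζ • w))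
      (fun ζ hζ => hsubU (hmem z hz ζ hζ))
      (fun ζ hζ => (hdl ζ hζ).differentiableAt.differentiableWithinAt) (mem_ball_self hr0)
    rw [(hdl 0 (hsubU (hmem z hz 0 (mem_closedBall_self hr0.le)))).deriv, zero_smul,
      add_zero] at h
    rw [← h, circleIntegral]
    simp only [hc, smul_smul, smul_eq_mul]
  exact ((hint.const_smul _).congr_of_eventuallyEq hcauchy).differentiableAt.differentiableWithinAt

/-- A holomorphic map on an open set of a finite-dimensional space is smooth. -/
theorem contDiffOn_of_differentiableOn_complex [FiniteDimensional ℂ E] [FiniteDimensional ℂ F]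
    {f : E → F} {U : Set E} (hU : IsOpen U) (hf : DifferentiableOn ℂ f U) :
    ContDiffOn ℂ ∞ f U := by
  have h : ∀ n : ℕ, ∀ f : E → F, DifferentiableOn ℂ f U → ContDiffOn ℂ n f U := by
    intro n
    induction n with
    | zero => exact fun f hf => contDiffOn_zero.2 hf.continuousOn
    | succ n ih =>
      intro f hf
      have := contDiffOn_succ_iff_fderiv_of_isOpen (𝕜 := ℂ) (n := (n : WithTop ℕ∞)) (f := f) hU
      refine this.2 ⟨hf, by simp, contDiffOn_clm_apply.2 fun w => ?_⟩
      exact ih _ (differentiableOn_fderiv_apply hU hf w)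
  exact contDiffOn_infty.2 fun n => h n f hf

end Holomorphic

/-! ### Cutting off vector fields -/

section Cutoff

open scoped Manifold

variable {E : Type*} [NormedAddCommGroup E] [NormedSpace ℝ E] [FiniteDimensional ℝ E]

/-- A vector field that is smooth near a compact set agrees near it with a compactly supported
smooth vector field. -/
theorem exists_compactlySupported_eqOn {V : E → E} {O C : Set E} (hO : IsOpen O)
    (hC : IsCompact C) (hCO : C ⊆ O) (hV : ContDiffOn ℝ ∞ V O) :
    ∃ (W : E → E) (O' : Set E), ContDiff ℝ ∞ W ∧ HasCompactSupport W ∧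
      IsOpen O' ∧ C ⊆ O' ∧ O' ⊆ O ∧ EqOn W V O' := by
  obtain ⟨S, hS, hCS, hSO⟩ := exists_compact_between hC hO hCO
  obtain ⟨χ, h1, h0, -⟩ := exists_contMDiffMap_one_nhds_of_subset_interior (n := (⊤ : ℕ∞)) 𝓘(ℝ, E)
    hC.isClosed hCS
  have hχ : ContDiff ℝ ∞ χ := χ.contMDiff.contDiff
  obtain ⟨O', hO', hCO', hO'χ⟩ := mem_nhdsSet_iff_exists.1 h1
  have hsupp : tsupport (fun x => χ x • V x) ⊆ S := by
    refine closure_minimal (fun x hx => ?_) hS.isClosed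
    by_contra hxS
    exact hx (by simp [h0 x hxS])
  refine ⟨fun x => χ x • V x, O' ∩ O, ?_, ?_, hO'.inter hO, subset_inter hCO' hCO,
    inter_subset_right, ?_⟩
  · refine contDiff_iff_contDiffAt.2 fun x => ?_
    by_cases hx : x ∈ tsupport fun x => χ x • V x
    · exact hχ.contDiffAt.smul (hV.contDiffAt (hO.mem_nhds (hSO (hsupp hx))))
    · exact (contDiffAt_const (c := (0 : E))).congr_of_eventuallyEq
        (notMem_tsupport_iff_eventuallyEq.1 hx)
  · exact hS.of_isClosed_subset (isClosed_tsupport _) hsupp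
  · intro x hx
    have : χ x = 1 := hO'χ hx.1
    simp [this]

end Cutoff

/-! ### Flows and one-forms -/

theorem two_le_infty : (2 : WithTop ℕ∞) ≤ ∞ :=
  WithTop.coe_le_coe.2 (le_top : (2 : ℕ∞) ≤ ⊤)

section FlowLemmas

universe u
variable {M : Type u} [NormedAddCommGroup M] [NormedSpace ℝ M] {W : M → M} {φ : ℝ → M → M}

namespace IsSmoothFlow

theorem neg_apply (h : IsSmoothFlow W φ) (t : ℝ) (x : M) : φ (-t) (φ t x) = x := by
  rw [← h.add, neg_add_cancel, h.zero]

theorem apply_neg (h : IsSmoothFlow W φ) (t : ℝ) (x : M) : φ t (φ (-t) x) = x := by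
  rw [← h.add, add_neg_cancel, h.zero]

theorem contDiff_slice (h : IsSmoothFlow W φ) (t : ℝ) : ContDiff ℝ ∞ (φ t) :=
  h.contDiff.comp (contDiff_const.prodMk contDiff_id)

theorem differentiable_slice (h : IsSmoothFlow W φ) (t : ℝ) : Differentiable ℝ (φ t) :=
  (h.contDiff_slice t).differentiable (by simp)

theorem continuous_slice (h : IsSmoothFlow W φ) (t : ℝ) : Continuous (φ t) :=
  (h.contDiff_slice t).continuous

theorem continuous_orbit (h : IsSmoothFlow W φ) (x : M) : Continuous fun t => φ t x :=
  h.contDiff.continuous.comp (continuous_id.prodMk continuous_const)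

theorem fderiv_comp_fderiv_neg (h : IsSmoothFlow W φ) (t : ℝ) (x v : M) :
    fderiv ℝ (φ t) (φ (-t) x) (fderiv ℝ (φ (-t)) x v) = v := by
  have h1 := ((h.differentiable_slice t) (φ (-t) x)).hasFDerivAt.comp x
    ((h.differentiable_slice (-t)) x).hasFDerivAt
  have h2 : HasFDerivAt (φ t ∘ φ (-t)) (ContinuousLinearMap.id ℝ M) x := by
    have : φ t ∘ φ (-t) = id := funext fun y => h.apply_neg t y
    rw [this]
    exact hasFDerivAt_id x
  exact congrArg (fun A : M →L[ℝ] M => A v) (h1.unique h2)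

/-- The variational equation: the derivative of the flow solves the linearized equation. It is the
symmetry of the second derivatives of `(t, x) ↦ φ_t(x)`. -/
theorem hasDerivAt_fderiv (h : IsSmoothFlow W φ) (hW : ContDiff ℝ ∞ W) (t : ℝ) (x v : M) :
    HasDerivAt (fun t => fderiv ℝ (φ t) x v)
      (fderiv ℝ W (φ t x) (fderiv ℝ (φ t) x v)) t := by
  set f : ℝ × M → M := fun q => φ q.1 q.2 with hf
  have hfd : Differentiable ℝ f := h.contDiff.differentiable (by simp)
  have hf' : ContDiff ℝ ∞ (fderiv ℝ f) := h.contDiff.fderiv_right (by simp)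
  have hf'd : Differentiable ℝ (fderiv ℝ f) := hf'.differentiable (by simp)
  have hspace : ∀ t, fderiv ℝ (φ t) x v = fderiv ℝ f (t, x) (0, v) := by
    intro t
    have h1 : HasFDerivAt (φ t) (fderiv ℝ f (t, x) ∘L .inr ℝ ℝ M) x :=
      (hfd (t, x)).hasFDerivAt.comp x (hasFDerivAt_prodMk_right t x)
    rw [h1.fderiv]
    simp
  have htime : ∀ q : ℝ × M, fderiv ℝ f q (1, 0) = W (f q) := by
    intro q
    have h1 : HasDerivAt (fun t => (t, q.2)) ((1 : ℝ), (0 : M)) q.1 :=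
      (hasDerivAt_id q.1).prodMk (hasDerivAt_const q.1 q.2)
    have h2 : HasDerivAt (fun t => φ t q.2) (fderiv ℝ f (q.1, q.2) (1, 0)) q.1 :=
      HasFDerivAt.comp_hasDerivAt (l := f) q.1 (hfd (q.1, q.2)).hasFDerivAt h1
    exact h2.unique (h.hasDerivAt q.1 q.2)
  have hsymm : fderiv ℝ (fderiv ℝ f) (t, x) (1, 0) (0, v)
      = fderiv ℝ (fderiv ℝ f) (t, x) (0, v) (1, 0) :=
    (h.contDiff.contDiffAt.isSymmSndFDerivAt (by simpa using two_le_infty)) _ _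
  have h2 : HasFDerivAt (fun q => fderiv ℝ f q (1, 0))
      ((fderiv ℝ W (f (t, x))).comp (fderiv ℝ f (t, x))) (t, x) := by
    simp only [htime]
    exact ((hW.differentiable (by simp)) _).hasFDerivAt.comp (t, x) (hfd (t, x)).hasFDerivAt
  have h3 : HasFDerivAt (fun q => fderiv ℝ f q (1, 0))
      ((fderiv ℝ (fderiv ℝ f) (t, x)).flip (1, 0)) (t, x) := by
    exact ((ContinuousLinearMap.apply ℝ M ((1 : ℝ), (0 : M))).hasFDerivAt).comp (t, x)
      (hf'd (t, x)).hasFDerivAt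
  have h4 := congrArg (fun A : ℝ × M →L[ℝ] M => A (0, v)) (h2.unique h3)
  simp only [ContinuousLinearMap.comp_apply, ContinuousLinearMap.flip_apply] at h4
  simp only [hspace]
  rw [show φ t x = f (t, x) from rfl, h4, ← hsymm]
  have h5 : HasDerivAt (fun t => (t, x)) ((1 : ℝ), (0 : M)) t :=
    (hasDerivAt_id t).prodMk (hasDerivAt_const t x)
  have h6 : HasDerivAt (fun t => fderiv ℝ f (t, x)) (fderiv ℝ (fderiv ℝ f) (t, x) (1, 0)) t :=
    (hf'd (t, x)).hasFDerivAt.comp_hasDerivAt t h5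
  exact ((ContinuousLinearMap.apply ℝ M ((0 : ℝ), v)).hasFDerivAt).comp_hasDerivAt t h6

/-- Cartan's formula along the flow: if `θ(W)` is locally constant, the derivative of the one-form
`θ` on a transported vector is `dθ(W, ·)`. -/
theorem hasDerivAt_oneForm (h : IsSmoothFlow W φ) (hW : ContDiff ℝ ∞ W) {θ : M → M →L[ℝ] ℝ}
    {c t : ℝ} {x : M} (hθ : DifferentiableAt ℝ θ (φ t x))
    (hc : ∀ᶠ y in 𝓝 (φ t x), θ y (W y) = c) (v : M) :
    HasDerivAt (fun t => θ (φ t x) (fderiv ℝ (φ t) x v))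
      (fderiv ℝ θ (φ t x) (W (φ t x)) (fderiv ℝ (φ t) x v)
        - fderiv ℝ θ (φ t x) (fderiv ℝ (φ t) x v) (W (φ t x))) t := by
  have h0 : HasDerivAt (fun t => θ (φ t x)) (fderiv ℝ θ (φ t x) (W (φ t x))) t :=
    hθ.hasFDerivAt.comp_hasDerivAt t (h.hasDerivAt t x)
  have h1 := h0.clm_apply (h.hasDerivAt_fderiv hW t x v)
  have h2 : HasFDerivAt (fun y => θ y (W y)) ((θ (φ t x)).comp (fderiv ℝ W (φ t x))
      + (fderiv ℝ θ (φ t x)).flip (W (φ t x))) (φ t x) :=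
    hθ.hasFDerivAt.clm_apply ((hW.differentiable (by simp)) (φ t x)).hasFDerivAt
  have h3 : HasFDerivAt (fun y => θ y (W y)) (0 : M →L[ℝ] ℝ) (φ t x) :=
    (hasFDerivAt_const c (φ t x)).congr_of_eventuallyEq hc
  have h4 := congrArg (fun A : M →L[ℝ] ℝ => A (fderiv ℝ (φ t) x v)) (h2.unique h3)
  simp only [add_apply, ContinuousLinearMap.comp_apply,
    ContinuousLinearMap.flip_apply, zero_apply] at h4
  rw [eq_neg_of_add_eq_zero_left h4, ← sub_eq_add_neg] at h1
  exact h1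

end IsSmoothFlow

end FlowLemmas

/-! ### The Levi form as a bilinear form -/

section Levi

variable {n : ℕ}

/-- Multiplication by `i` on `ℂⁿ`, as a real linear map. -/
noncomputable def mulI (n : ℕ) : CSpace n →L[ℝ] CSpace n :=
  (Complex.I • ContinuousLinearMap.id ℂ (CSpace n)).restrictScalars ℝ

@[simp]
theorem mulI_apply (v : CSpace n) : mulI n v = Complex.I • v := rfl

theorem I_smul_I_smul (v : CSpace n) : Complex.I • Complex.I • v = -v := by
  rw [smul_smul, Complex.I_mul_I, neg_one_smul]

/-- The `i`-invariant part `B(u, v) + B(iu, iv)` of a real bilinear form `B`, up to a factor. -/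
noncomputable def leviBilin (B : CSpace n →L[ℝ] CSpace n →L[ℝ] ℝ) :
    CSpace n →L[ℝ] CSpace n →L[ℝ] ℝ :=
  B + ((ContinuousLinearMap.compL ℝ (CSpace n) (CSpace n) ℝ).flip (mulI n)).comp (B.comp (mulI n))

@[simp]
theorem leviBilin_apply (B : CSpace n →L[ℝ] CSpace n →L[ℝ] ℝ) (u v : CSpace n) :
    leviBilin B u v = B u v + B (Complex.I • u) (Complex.I • v) := rfl

theorem leviForm_eq_leviBilin (ρ : CSpace n → ℝ) (z w : CSpace n) :
    leviForm ρ z w = leviBilin (fderiv ℝ (fderiv ℝ ρ) z) w w / 4 := rfl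

/-- A positive definite bilinear form on a finite-dimensional space identifies it with its dual. -/
theorem isInvertible_of_pos {E : Type*} [NormedAddCommGroup E] [NormedSpace ℝ E]
    [FiniteDimensional ℝ E] {L : E →L[ℝ] E →L[ℝ] ℝ} (hL : ∀ w, w ≠ 0 → 0 < L w w) :
    L.IsInvertible := by
  have hinj : Function.Injective (L : E →ₗ[ℝ] E →L[ℝ] ℝ) := by
    rw [injective_iff_map_eq_zero]
    intro w hw
    by_contra hne
    have h1 := hL w hne
    have h2 : L w = 0 := hw
    simp [h2] at h1
  have hdim : Module.finrank ℝ E = Module.finrank ℝ (E →L[ℝ] ℝ) := by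
    rw [← (LinearMap.toContinuousLinearMap (𝕜 := ℝ) (E := E) (F' := ℝ)).finrank_eq]
    exact (Subspace.dual_finrank_eq (K := ℝ) (V := E)).symm
  refine ⟨(LinearEquiv.ofInjectiveOfFinrankEq _ hinj hdim).toContinuousLinearEquiv, ?_⟩
  ext u v
  rfl

end Levi

/-! ### The vector field of Gray's stability theorem -/

section GrayField

variable {n : ℕ} (L : CSpace n →L[ℝ] CSpace n →L[ℝ] ℝ) (A δ : CSpace n →L[ℝ] ℝ) (G : ℝ)

/-- The multiplier of `A` in the equation that defines `grayField`. -/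
noncomputable def grayCoeff : ℝ := (A (L.inverse δ) - G) / A (L.inverse A)

/-- The vector `Y` with `A(Y) = -G`, `A(iY) = 0` and
`L(Y, u) = -δ(u) + c A(u) + c' A(iu)` for some multipliers `c` and `c'`. -/
noncomputable def grayField : CSpace n :=
  -L.inverse δ + grayCoeff L A δ G • L.inverse A
    - (A (Complex.I • L.inverse δ) / A (L.inverse A)) • (Complex.I • L.inverse A)

variable {L A δ G}

theorem grayField_spec {B : CSpace n →L[ℝ] CSpace n →L[ℝ] ℝ} (hB : ∀ u v, B u v = B v u)
    (hL : (leviBilin B).IsInvertible) (hA : A ((leviBilin B).inverse A) ≠ 0) :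
    A (grayField (leviBilin B) A δ G) = -G ∧
    A (Complex.I • grayField (leviBilin B) A δ G) = 0 ∧
    ∀ u, A u = 0 → leviBilin B (grayField (leviBilin B) A δ G) (Complex.I • u)
      = -δ (Complex.I • u) + grayCoeff (leviBilin B) A δ G * A (Complex.I • u) := by
  set S := (leviBilin B).inverse with hS
  have hinv : ∀ η : CSpace n →L[ℝ] ℝ, leviBilin B (S η) = η := fun η => by
    obtain ⟨e, he⟩ := hL
    rw [hS, ← he, ContinuousLinearMap.inverse_equiv]
    exact e.apply_symm_apply η
  have hI : ∀ u v, leviBilin B (Complex.I • u) v = -leviBilin B u (Complex.I • v) := by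
    intro u v
    simp only [leviBilin_apply, I_smul_I_smul, map_neg, neg_apply]
    ring
  have hsymm : ∀ u v, leviBilin B u v = leviBilin B v u := by
    intro u v
    simp only [leviBilin_apply]
    rw [hB, hB (Complex.I • u)]
  have hAI : A (Complex.I • S A) = 0 := by
    have h1 : leviBilin B (S A) (Complex.I • S A) = A (Complex.I • S A) := by rw [hinv]
    have h2 := hI (S A) (S A)
    rw [hsymm, h1] at h2
    linarith
  refine ⟨?_, ?_, fun u hu => ?_⟩
  · simp only [grayField, grayCoeff, map_add, map_sub, map_neg, map_smul, ← hS, hAI, smul_eq_mul]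
    field_simp
    ring
  · have hc : ∀ (c : ℝ) (v : CSpace n), Complex.I • c • v = c • Complex.I • v :=
      fun c v => smul_comm _ _ _
    simp only [grayField, grayCoeff, smul_add, smul_sub, smul_neg, hc, I_smul_I_smul, map_add,
      map_sub, map_neg, map_smul, ← hS, hAI, smul_eq_mul]
    field_simp
    ring
  · simp only [grayField, map_add, map_sub, map_neg, map_smul, ← hS, hinv, hI, smul_eq_mul,
      add_apply, sub_apply, neg_apply, smul_apply, I_smul_I_smul, hu]
    ring

end GrayField

section SmoothDependence

variable {n : ℕ} {M : Type*} [NormedAddCommGroup M] [NormedSpace ℝ M]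
  {L : M → CSpace n →L[ℝ] CSpace n →L[ℝ] ℝ} {A δ : M → CSpace n →L[ℝ] ℝ} {G : M → ℝ} {O : Set M}

theorem contDiffOn_inverse_apply (hO : ∀ q ∈ O, (L q).IsInvertible) (hL : ContDiffOn ℝ ∞ L O)
    (hA : ContDiffOn ℝ ∞ A O) : ContDiffOn ℝ ∞ (fun q => (L q).inverse (A q)) O := by
  refine ContDiffOn.clm_apply (fun q hq => ?_) hA
  obtain ⟨e, he⟩ := hO q hq
  have h1 : ContDiffAt ℝ ∞ ContinuousLinearMap.inverse (L q) := by
    rw [← he]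
    exact contDiffAt_map_inverse e
  exact h1.comp_contDiffWithinAt q (hL q hq)

theorem contDiffOn_grayCoeff (hO : ∀ q ∈ O, (L q).IsInvertible)
    (hA0 : ∀ q ∈ O, A q ((L q).inverse (A q)) ≠ 0) (hL : ContDiffOn ℝ ∞ L O)
    (hA : ContDiffOn ℝ ∞ A O) (hδ : ContDiffOn ℝ ∞ δ O) (hG : ContDiffOn ℝ ∞ G O) :
    ContDiffOn ℝ ∞ (fun q => grayCoeff (L q) (A q) (δ q) (G q)) O :=
  ((hA.clm_apply (contDiffOn_inverse_apply hO hL hδ)).sub hG).div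
    (hA.clm_apply (contDiffOn_inverse_apply hO hL hA)) hA0

theorem contDiffOn_grayField (hO : ∀ q ∈ O, (L q).IsInvertible)
    (hA0 : ∀ q ∈ O, A q ((L q).inverse (A q)) ≠ 0) (hL : ContDiffOn ℝ ∞ L O)
    (hA : ContDiffOn ℝ ∞ A O) (hδ : ContDiffOn ℝ ∞ δ O) (hG : ContDiffOn ℝ ∞ G O) :
    ContDiffOn ℝ ∞ (fun q => grayField (L q) (A q) (δ q) (G q)) O := by
  have hSδ := contDiffOn_inverse_apply hO hL hδ
  have hSA := contDiffOn_inverse_apply hO hL hA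
  have hIδ : ContDiffOn ℝ ∞ (fun q => Complex.I • (L q).inverse (δ q)) O :=
    (mulI n).contDiff.comp_contDiffOn hSδ
  have hIA : ContDiffOn ℝ ∞ (fun q => Complex.I • (L q).inverse (A q)) O :=
    (mulI n).contDiff.comp_contDiffOn hSA
  exact (hSδ.neg.add ((contDiffOn_grayCoeff hO hA0 hL hA hδ hG).smul hSA)).sub
    (((hA.clm_apply hIδ).div (hA.clm_apply hSA) hA0).smul hIA)

end SmoothDependence

/-! ### Gray stability for a linear pencil of functions -/

section Gray

variable {n : ℕ} {F₁ F₂ : CSpace n → ℝ} {N : Set (CSpace n)}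

/-- The linear interpolation `(1 - s) f + s g` at the point `(s, z)`. -/
def pencil {n : ℕ} {H : Type*} [AddCommGroup H] [Module ℝ H] (f g : CSpace n → H)
    (q : ℝ × CSpace n) : H :=
  (1 - q.1) • f q.2 + q.1 • g q.2

theorem contDiffOn_pencil {H : Type*} [NormedAddCommGroup H] [NormedSpace ℝ H]
    {f g : CSpace n → H} (hf : ContDiffOn ℝ ∞ f N) (hg : ContDiffOn ℝ ∞ g N) :
    ContDiffOn ℝ ∞ (pencil f g) (univ ×ˢ N) := by
  have h2 : MapsTo Prod.snd ((univ : Set ℝ) ×ˢ N) N := fun q hq => hq.2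
  exact ((contDiffOn_const.sub contDiffOn_fst).smul (hf.comp contDiffOn_snd h2)).add
    (contDiffOn_fst.smul (hg.comp contDiffOn_snd h2))

theorem hasFDerivAt_pencil {H : Type*} [NormedAddCommGroup H] [NormedSpace ℝ H]
    {f g : CSpace n → H} {q : ℝ × CSpace n} (hf : DifferentiableAt ℝ f q.2)
    (hg : DifferentiableAt ℝ g q.2) :
    HasFDerivAt (pencil f g)
      ((ContinuousLinearMap.fst ℝ ℝ (CSpace n)).smulRight (g q.2 - f q.2)
        + (pencil (fderiv ℝ f) (fderiv ℝ g) q).comp (ContinuousLinearMap.snd ℝ ℝ (CSpace n))) q := by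
  have hf' : HasFDerivAt (fun q : ℝ × CSpace n => f q.2)
      ((fderiv ℝ f q.2).comp (ContinuousLinearMap.snd ℝ ℝ (CSpace n))) q :=
    hf.hasFDerivAt.comp q hasFDerivAt_snd
  have hg' : HasFDerivAt (fun q : ℝ × CSpace n => g q.2)
      ((fderiv ℝ g q.2).comp (ContinuousLinearMap.snd ℝ ℝ (CSpace n))) q :=
    hg.hasFDerivAt.comp q hasFDerivAt_snd
  have h1 : HasFDerivAt (fun q : ℝ × CSpace n => q.1) (ContinuousLinearMap.fst ℝ ℝ (CSpace n)) q :=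
    hasFDerivAt_fst
  refine (((h1.const_sub 1).smul hf').add (h1.smul hg')).congr_fderiv ?_
  ext v
  · simp [pencil, smul_sub]
    abel
  · simp [pencil]

/-- The union of the level sets `{(1 - s) F₁ + s F₂ = 1}`, for `0 ≤ s ≤ 1`, in `ℝ × ℂⁿ`. -/
def levelTrack (F₁ F₂ : CSpace n → ℝ) (N : Set (CSpace n)) : Set (ℝ × CSpace n) :=
  {q | q.1 ∈ Icc (0 : ℝ) 1 ∧ q.2 ∈ N ∧ pencil F₁ F₂ q = 1}

/-- The data of Gray's isotopy near the compact set `levelTrack F₁ F₂ N`: the field `Y` moves the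
level sets into each other, and its contraction with the Levi form cancels, on the complex tangent
spaces, the derivative in `s` of the contact forms `v ↦ d((1 - s) F₁ + s F₂)(iv)`. -/
theorem exists_grayField (hN : IsOpen N) (h₁ : ContDiffOn ℝ ∞ F₁ N) (h₂ : ContDiffOn ℝ ∞ F₂ N)
    (hpos : ∀ q ∈ levelTrack F₁ F₂ N, ∀ w, w ≠ 0 → 0 < leviForm F₁ q.2 w ∧ 0 < leviForm F₂ q.2 w)
    (hdir : ∀ q ∈ levelTrack F₁ F₂ N, ∃ v, fderiv ℝ F₁ q.2 v < 0 ∧ fderiv ℝ F₂ q.2 v < 0) :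
    ∃ (O : Set (ℝ × CSpace n)) (Y : ℝ × CSpace n → CSpace n) (c : ℝ × CSpace n → ℝ),
      IsOpen O ∧ levelTrack F₁ F₂ N ⊆ O ∧ O ⊆ univ ×ˢ N ∧
      ContDiffOn ℝ ∞ Y O ∧ ContinuousOn c O ∧ ∀ q ∈ O,
        pencil (fderiv ℝ F₁) (fderiv ℝ F₂) q (Y q) = -(F₂ q.2 - F₁ q.2) ∧
        pencil (fderiv ℝ F₁) (fderiv ℝ F₂) q (Complex.I • Y q) = 0 ∧
        ∀ u, pencil (fderiv ℝ F₁) (fderiv ℝ F₂) q u = 0 →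
          leviBilin (pencil (fderiv ℝ (fderiv ℝ F₁)) (fderiv ℝ (fderiv ℝ F₂)) q) (Y q)
            (Complex.I • u) = -(fderiv ℝ F₂ q.2 - fderiv ℝ F₁ q.2) (Complex.I • u)
            + c q * pencil (fderiv ℝ F₁) (fderiv ℝ F₂) q (Complex.I • u) := by
  set A := pencil (fderiv ℝ F₁) (fderiv ℝ F₂) with hA
  set B := pencil (fderiv ℝ (fderiv ℝ F₁)) (fderiv ℝ (fderiv ℝ F₂)) with hB
  have hd₁ : ContDiffOn ℝ ∞ (fderiv ℝ F₁) N := h₁.fderiv_of_isOpen hN (by simp)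
  have hd₂ : ContDiffOn ℝ ∞ (fderiv ℝ F₂) N := h₂.fderiv_of_isOpen hN (by simp)
  have hdd₁ : ContDiffOn ℝ ∞ (fderiv ℝ (fderiv ℝ F₁)) N := hd₁.fderiv_of_isOpen hN (by simp)
  have hdd₂ : ContDiffOn ℝ ∞ (fderiv ℝ (fderiv ℝ F₂)) N := hd₂.fderiv_of_isOpen hN (by simp)
  have hAs : ContDiffOn ℝ ∞ A (univ ×ˢ N) := contDiffOn_pencil hd₁ hd₂
  have hBs : ContDiffOn ℝ ∞ B (univ ×ˢ N) := contDiffOn_pencil hdd₁ hdd₂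
  have hLs : ContDiffOn ℝ ∞ (fun q => leviBilin (B q)) (univ ×ˢ N) :=
    hBs.add (contDiffOn_const.clm_comp (hBs.clm_comp contDiffOn_const))
  have hsnd : MapsTo Prod.snd ((univ : Set ℝ) ×ˢ N) N := fun q hq => hq.2
  have hδs : ContDiffOn ℝ ∞ (fun q : ℝ × CSpace n => fderiv ℝ F₂ q.2 - fderiv ℝ F₁ q.2)
      (univ ×ˢ N) := (hd₂.comp contDiffOn_snd hsnd).sub (hd₁.comp contDiffOn_snd hsnd)
  have hGs : ContDiffOn ℝ ∞ (fun q : ℝ × CSpace n => F₂ q.2 - F₁ q.2) (univ ×ˢ N) :=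
    (h₂.comp contDiffOn_snd hsnd).sub (h₁.comp contDiffOn_snd hsnd)
  have hNo : IsOpen ((univ : Set ℝ) ×ˢ N) := isOpen_univ.prod hN
  set O₁ : Set (ℝ × CSpace n) := (univ ×ˢ N) ∩ (fun q => leviBilin (B q)) ⁻¹'
    range ((↑) : (CSpace n ≃L[ℝ] (CSpace n →L[ℝ] ℝ)) → CSpace n →L[ℝ] CSpace n →L[ℝ] ℝ) with hO₁
  have hO₁o : IsOpen O₁ := hLs.continuousOn.isOpen_inter_preimage hNo ContinuousLinearEquiv.isOpen
  have hO₁i : ∀ q ∈ O₁, (leviBilin (B q)).IsInvertible := fun q hq => hq.2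
  have hO₁N : O₁ ⊆ univ ×ˢ N := inter_subset_left
  have hAS : ContDiffOn ℝ ∞ (fun q => A q ((leviBilin (B q)).inverse (A q))) O₁ :=
    (hAs.mono hO₁N).clm_apply (contDiffOn_inverse_apply hO₁i (hLs.mono hO₁N) (hAs.mono hO₁N))
  set O : Set (ℝ × CSpace n) := O₁ ∩ (fun q => A q ((leviBilin (B q)).inverse (A q))) ⁻¹' {0}ᶜ
    with hO
  have hOo : IsOpen O := hAS.continuousOn.isOpen_inter_preimage hO₁o isOpen_compl_singleton
  have hOO₁ : O ⊆ O₁ := inter_subset_left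
  have hON : O ⊆ univ ×ˢ N := hOO₁.trans hO₁N
  have hOi : ∀ q ∈ O, (leviBilin (B q)).IsInvertible := fun q hq => hO₁i q (hOO₁ hq)
  have hO0 : ∀ q ∈ O, A q ((leviBilin (B q)).inverse (A q)) ≠ 0 := fun q hq => hq.2
  have hCO : levelTrack F₁ F₂ N ⊆ O := by
    intro q hq
    obtain ⟨⟨hs0, hs1⟩, hqN, hq1⟩ := hq
    have hLpos : ∀ w, w ≠ 0 → 0 < leviBilin (B q) w w := by
      intro w hw
      obtain ⟨p1, p2⟩ := hpos q ⟨⟨hs0, hs1⟩, hqN, hq1⟩ w hw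
      rw [leviForm_eq_leviBilin] at p1 p2
      have : leviBilin (B q) w w
          = (1 - q.1) * leviBilin (fderiv ℝ (fderiv ℝ F₁) q.2) w w
            + q.1 * leviBilin (fderiv ℝ (fderiv ℝ F₂) q.2) w w := by
        simp only [hB, pencil, leviBilin_apply, add_apply, smul_apply, smul_eq_mul]
        ring
      rw [this]
      rcases eq_or_lt_of_le hs0 with h | h
      · rw [← h]; linarith
      · have := mul_pos h (by linarith : 0 < leviBilin (fderiv ℝ (fderiv ℝ F₂) q.2) w w)
        have := mul_nonneg (sub_nonneg.2 hs1)
          (by linarith : 0 ≤ leviBilin (fderiv ℝ (fderiv ℝ F₁) q.2) w w)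
        linarith
    have hinv := isInvertible_of_pos hLpos
    refine ⟨⟨⟨trivial, hqN⟩, hinv⟩, ?_⟩
    obtain ⟨e, he⟩ := hinv
    have hne : A q ≠ 0 := by
      obtain ⟨v, p1, p2⟩ := hdir q ⟨⟨hs0, hs1⟩, hqN, hq1⟩
      intro h0
      have h3 : (1 - q.1) * fderiv ℝ F₁ q.2 v + q.1 * fderiv ℝ F₂ q.2 v = 0 := by
        have := congrArg (fun η : CSpace n →L[ℝ] ℝ => η v) h0
        simpa [hA, pencil] using this
      rcases eq_or_lt_of_le hs0 with h | h
      · rw [← h] at h3; linarith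
      · have := mul_neg_of_pos_of_neg h p2
        have := mul_nonpos_of_nonneg_of_nonpos (sub_nonneg.2 hs1) p1.le
        linarith
    have hSA : (leviBilin (B q)).inverse (A q) ≠ 0 := by
      intro h0
      apply hne
      rw [← he, ContinuousLinearMap.inverse_equiv] at h0
      exact e.symm.map_eq_zero_iff.1 h0
    have hval : A q ((leviBilin (B q)).inverse (A q))
        = leviBilin (B q) ((leviBilin (B q)).inverse (A q)) ((leviBilin (B q)).inverse (A q)) := by
      congr 1
      rw [← he, ContinuousLinearMap.inverse_equiv]
      exact (e.apply_symm_apply _).symm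
    change A q ((leviBilin (B q)).inverse (A q)) ≠ 0
    rw [hval]
    exact (hLpos _ hSA).ne'
  refine ⟨O, fun q => grayField (leviBilin (B q)) (A q) (fderiv ℝ F₂ q.2 - fderiv ℝ F₁ q.2)
      (F₂ q.2 - F₁ q.2),
    fun q => grayCoeff (leviBilin (B q)) (A q) (fderiv ℝ F₂ q.2 - fderiv ℝ F₁ q.2)
      (F₂ q.2 - F₁ q.2), hOo, hCO, hON,
    contDiffOn_grayField hOi hO0 (hLs.mono hON) (hAs.mono hON) (hδs.mono hON) (hGs.mono hON),
    (contDiffOn_grayCoeff hOi hO0 (hLs.mono hON) (hAs.mono hON) (hδs.mono hON)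
      (hGs.mono hON)).continuousOn, fun q hq => ?_⟩
  refine grayField_spec (fun u v => ?_) (hOi q hq) (hO0 q hq)
  have hs₁ : IsSymmSndFDerivAt ℝ F₁ q.2 :=
    (h₁.contDiffAt (hN.mem_nhds (hON hq).2)).isSymmSndFDerivAt (by simpa using two_le_infty)
  have hs₂ : IsSymmSndFDerivAt ℝ F₂ q.2 :=
    (h₂.contDiffAt (hN.mem_nhds (hON hq).2)).isSymmSndFDerivAt (by simpa using two_le_infty)
  simp only [hB, pencil, add_apply, smul_apply]
  rw [hs₁ u v, hs₂ u v]

/-- Along the flow of a field that equals `(1, Y)` near the level track, with `Y` tangent to the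
moving level sets, the level track is invariant as long as the parameter stays in `[0, 1]`. -/
theorem flow_mem_levelTrack (hN : IsOpen N) (h₁ : ContDiffOn ℝ ∞ F₁ N) (h₂ : ContDiffOn ℝ ∞ F₂ N)
    (hC : IsCompact (levelTrack F₁ F₂ N)) {O : Set (ℝ × CSpace n)} (hO : IsOpen O)
    (hCO : levelTrack F₁ F₂ N ⊆ O) (hON : O ⊆ univ ×ˢ N)
    {W : ℝ × CSpace n → ℝ × CSpace n} {φ : ℝ → ℝ × CSpace n → ℝ × CSpace n}
    (hφ : IsSmoothFlow W φ) (hW1 : ∀ q ∈ O, (W q).1 = 1)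
    (hW2 : ∀ q ∈ O, pencil (fderiv ℝ F₁) (fderiv ℝ F₂) q (W q).2 = -(F₂ q.2 - F₁ q.2))
    {q₀ : ℝ × CSpace n} (hq₀ : q₀ ∈ levelTrack F₁ F₂ N) {T : ℝ} (hT : q₀.1 + T ∈ Icc (0 : ℝ) 1) :
    ∀ τ ∈ Icc (0 : ℝ) 1, φ (τ * T) q₀ ∈ levelTrack F₁ F₂ N ∧ (φ (τ * T) q₀).1 = q₀.1 + τ * T := by
  have hcont : Continuous fun τ : ℝ => φ (τ * T) q₀ :=
    (hφ.continuous_orbit q₀).comp (by fun_prop)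
  have hder : ∀ τ, HasDerivAt (fun τ : ℝ => φ (τ * T) q₀) (T • W (φ (τ * T) q₀)) τ := by
    intro τ
    have h1 : HasDerivAt (fun τ : ℝ => τ * T) T τ := by
      simpa using (hasDerivAt_id τ).mul_const T
    exact (hφ.hasDerivAt (τ * T) q₀).scomp τ h1
  suffices h : Icc (0 : ℝ) 1 ⊆ {τ | φ (τ * T) q₀ ∈ levelTrack F₁ F₂ N ∧
      (φ (τ * T) q₀).1 = q₀.1 + τ * T} from h
  refine IsClosed.Icc_subset_of_forall_mem_nhdsWithin ?_ ?_ ?_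
  · refine IsClosed.inter ?_ isClosed_Icc
    exact (hC.isClosed.preimage hcont).inter
      (isClosed_eq (continuous_fst.comp hcont) (by fun_prop))
  · simpa [hφ.zero] using hq₀
  · rintro τ₀ ⟨⟨hτ₀, hτ₀1⟩, hτ₀I⟩
    have hnear : ∀ᶠ τ in 𝓝 τ₀, φ (τ * T) q₀ ∈ O :=
      hcont.continuousAt.eventually (hO.mem_nhds (hCO hτ₀))
    obtain ⟨ε, hε, hball⟩ := Metric.eventually_nhds_iff_ball.1 hnear
    have hball_conn : IsPreconnected (Metric.ball τ₀ ε) := (convex_ball τ₀ ε).isPreconnected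
    have hfst : ∀ τ ∈ Metric.ball τ₀ ε,
        HasDerivAt (fun τ : ℝ => (φ (τ * T) q₀).1 - τ * T) 0 τ := by
      intro τ hτ
      have h1 : HasDerivAt (fun τ : ℝ => (φ (τ * T) q₀).1) (T • W (φ (τ * T) q₀)).1 τ :=
        (ContinuousLinearMap.fst ℝ ℝ (CSpace n)).hasFDerivAt.comp_hasDerivAt τ (hder τ)
      have h2 : HasDerivAt (fun τ : ℝ => τ * T) T τ := by
        simpa using (hasDerivAt_id τ).mul_const T
      have h3 := h1.sub h2
      rw [Prod.smul_fst, hW1 _ (hball τ hτ), smul_eq_mul, mul_one, sub_self] at h3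
      exact h3
    have hlev : ∀ τ ∈ Metric.ball τ₀ ε,
        HasDerivAt (fun τ : ℝ => pencil F₁ F₂ (φ (τ * T) q₀)) 0 τ := by
      intro τ hτ
      have hN' := hN.mem_nhds (hON (hball τ hτ)).2
      have h1 := (hasFDerivAt_pencil ((h₁.contDiffAt hN').differentiableAt (by simp))
        ((h₂.contDiffAt hN').differentiableAt (by simp))).comp_hasDerivAt τ (hder τ)
      refine h1.congr_deriv ?_
      have h2 := hW2 _ (hball τ hτ)
      have h3 := hW1 _ (hball τ hτ)
      simp only [map_smul, add_apply, ContinuousLinearMap.smulRight_apply,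
        ContinuousLinearMap.coe_fst', ContinuousLinearMap.comp_apply,
        ContinuousLinearMap.coe_snd', h2, h3, smul_eq_mul]
      ring
    have hc1 : ∀ τ ∈ Metric.ball τ₀ ε, (φ (τ * T) q₀).1 - τ * T = (φ (τ₀ * T) q₀).1 - τ₀ * T :=
      fun τ hτ => Metric.isOpen_ball.is_const_of_deriv_eq_zero hball_conn
        (fun τ hτ => (hfst τ hτ).differentiableAt.differentiableWithinAt)
        (fun τ hτ => (hfst τ hτ).deriv) hτ (Metric.mem_ball_self hε)
    have hc2 : ∀ τ ∈ Metric.ball τ₀ ε,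
        pencil F₁ F₂ (φ (τ * T) q₀) = pencil F₁ F₂ (φ (τ₀ * T) q₀) :=
      fun τ hτ => Metric.isOpen_ball.is_const_of_deriv_eq_zero hball_conn
        (fun τ hτ => (hlev τ hτ).differentiableAt.differentiableWithinAt)
        (fun τ hτ => (hlev τ hτ).deriv) hτ (Metric.mem_ball_self hε)
    have hIoc : Ioc τ₀ 1 ∈ 𝓝[>] τ₀ := Ioc_mem_nhdsGT hτ₀I.2
    filter_upwards [hIoc, nhdsWithin_le_nhds (Metric.ball_mem_nhds τ₀ hε)] with τ hτ hτb
    have e1 : (φ (τ * T) q₀).1 = q₀.1 + τ * T := by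
      have := hc1 τ hτb
      rw [hτ₀1] at this
      linarith
    refine ⟨⟨?_, (hON (hball τ hτb)).2, (hc2 τ hτb).trans hτ₀.2.2⟩, e1⟩
    rw [e1]
    have hτ0 : 0 ≤ τ := hτ₀I.1.trans hτ.1.le
    have hq := hq₀.1
    constructor
    · nlinarith [hq.1, hT.1, hτ.2]
    · nlinarith [hq.2, hT.2, hτ.2]

/-- The flow of Gray's field carries complex tangent vectors of the level sets to complex tangent
vectors: for `v` transported by the flow, `d((1 - s) F₁ + s F₂)(v)` is constant and
`d((1 - s) F₁ + s F₂)(iv)` solves a homogeneous linear differential equation. -/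
theorem fderiv_flow_mem_complexTangent (hN : IsOpen N) (h₁ : ContDiffOn ℝ ∞ F₁ N)
    (h₂ : ContDiffOn ℝ ∞ F₂ N)
    (hC : IsCompact (levelTrack F₁ F₂ N)) {O : Set (ℝ × CSpace n)} (hO : IsOpen O)
    (hCO : levelTrack F₁ F₂ N ⊆ O) (hON : O ⊆ univ ×ˢ N)
    {W : ℝ × CSpace n → ℝ × CSpace n} {φ : ℝ → ℝ × CSpace n → ℝ × CSpace n}
    {c : ℝ × CSpace n → ℝ} (hc : ContinuousOn c O)
    (hW : ContDiff ℝ ∞ W) (hφ : IsSmoothFlow W φ) (hW1 : ∀ q ∈ O, (W q).1 = 1)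
    (hW2 : ∀ q ∈ O, pencil (fderiv ℝ F₁) (fderiv ℝ F₂) q (W q).2 = -(F₂ q.2 - F₁ q.2))
    (hW3 : ∀ q ∈ O, pencil (fderiv ℝ F₁) (fderiv ℝ F₂) q (Complex.I • (W q).2) = 0)
    (hW4 : ∀ q ∈ O, ∀ u, pencil (fderiv ℝ F₁) (fderiv ℝ F₂) q u = 0 →
      leviBilin (pencil (fderiv ℝ (fderiv ℝ F₁)) (fderiv ℝ (fderiv ℝ F₂)) q) (W q).2
        (Complex.I • u) = -(fderiv ℝ F₂ q.2 - fderiv ℝ F₁ q.2) (Complex.I • u)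
        + c q * pencil (fderiv ℝ F₁) (fderiv ℝ F₂) q (Complex.I • u))
    {q₀ : ℝ × CSpace n} (hq₀ : q₀ ∈ levelTrack F₁ F₂ N) {T : ℝ} (hT : q₀.1 + T ∈ Icc (0 : ℝ) 1)
    {w : CSpace n} (hw : pencil (fderiv ℝ F₁) (fderiv ℝ F₂) q₀ w = 0)
    (hw' : pencil (fderiv ℝ F₁) (fderiv ℝ F₂) q₀ (Complex.I • w) = 0) :
    (fderiv ℝ (φ T) q₀ (0, w)).1 = 0 ∧
    pencil (fderiv ℝ F₁) (fderiv ℝ F₂) (φ T q₀) (fderiv ℝ (φ T) q₀ (0, w)).2 = 0 ∧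
    pencil (fderiv ℝ F₁) (fderiv ℝ F₂) (φ T q₀)
      (Complex.I • (fderiv ℝ (φ T) q₀ (0, w)).2) = 0 := by
  set A := pencil (fderiv ℝ F₁) (fderiv ℝ F₂) with hA
  set v : ℝ → ℝ × CSpace n := fun t => fderiv ℝ (φ t) q₀ (0, w) with hv
  have hv0 : v 0 = (0, w) := by
    have : φ 0 = id := funext hφ.zero
    simp [hv, this]
  have hmem : ∀ τ ∈ Icc (0 : ℝ) 1, φ (τ * T) q₀ ∈ O := fun τ hτ =>
    hCO (flow_mem_levelTrack hN h₁ h₂ hC hO hCO hON hφ hW1 hW2 hq₀ hT τ hτ).1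
  have hmul : ∀ τ : ℝ, HasDerivAt (fun τ : ℝ => τ * T) T τ := fun τ => by
    simpa using (hasDerivAt_id τ).mul_const T
  have hd₁ : ContDiffOn ℝ ∞ (fderiv ℝ F₁) N := h₁.fderiv_of_isOpen hN (by simp)
  have hd₂ : ContDiffOn ℝ ∞ (fderiv ℝ F₂) N := h₂.fderiv_of_isOpen hN (by simp)
  have hP : ContDiffOn ℝ ∞ (pencil F₁ F₂) (univ ×ˢ N) := contDiffOn_pencil h₁ h₂
  have hNo : IsOpen ((univ : Set ℝ) ×ˢ N) := isOpen_univ.prod hN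
  have hdP : ∀ q ∈ O, ∀ u : ℝ × CSpace n,
      fderiv ℝ (pencil F₁ F₂) q u = u.1 * (F₂ q.2 - F₁ q.2) + A q u.2 := by
    intro q hq u
    have hN' := hN.mem_nhds (hON hq).2
    rw [(hasFDerivAt_pencil ((h₁.contDiffAt hN').differentiableAt (by simp))
      ((h₂.contDiffAt hN').differentiableAt (by simp))).fderiv]
    simp [hA]
  have hdA : ∀ q ∈ O, HasFDerivAt A _ q := fun q hq =>
    hasFDerivAt_pencil (((hd₁.contDiffAt (hN.mem_nhds (hON hq).2))).differentiableAt (by simp))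
      (((hd₂.contDiffAt (hN.mem_nhds (hON hq).2))).differentiableAt (by simp))
  -- the component along the parameter axis stays zero
  have hσ : ∀ τ ∈ Icc (0 : ℝ) 1, (v (τ * T)).1 = 0 := by
    have hder : ∀ τ ∈ Icc (0 : ℝ) 1, HasDerivAt (fun τ : ℝ => (v (τ * T)).1) 0 τ := by
      intro τ hτ
      have h := hφ.hasDerivAt_oneForm hW (θ := fun _ => ContinuousLinearMap.fst ℝ ℝ (CSpace n))
        (c := 1) (t := τ * T) (x := q₀) (differentiableAt_const _)
        (by filter_upwards [hO.mem_nhds (hmem τ hτ)] with q hq using hW1 q hq) (0, w)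
      have h' := h.comp τ (hmul τ)
      refine h'.congr_deriv ?_
      simp
    intro τ hτ
    have := constant_of_has_deriv_right_zero
      (fun τ hτ => (hder τ hτ).continuousAt.continuousWithinAt)
      (fun τ hτ => (hder τ (Ico_subset_Icc_self hτ)).hasDerivWithinAt) τ hτ
    rw [this, zero_mul, hv0]
  -- the differential of the defining function is constant along the flow
  have ha : ∀ τ ∈ Icc (0 : ℝ) 1, A (φ (τ * T) q₀) (v (τ * T)).2 = 0 := by
    have hder : ∀ τ ∈ Icc (0 : ℝ) 1, HasDerivAt
        (fun τ : ℝ => fderiv ℝ (pencil F₁ F₂) (φ (τ * T) q₀) (v (τ * T))) 0 τ := by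
      intro τ hτ
      have hcd := hP.contDiffAt (hNo.mem_nhds (hON (hmem τ hτ)))
      have hdiff : DifferentiableAt ℝ (fderiv ℝ (pencil F₁ F₂)) (φ (τ * T) q₀) :=
        (((hP.fderiv_of_isOpen (m := ∞) hNo (by simp)).contDiffAt
          (hNo.mem_nhds (hON (hmem τ hτ)))).differentiableAt (by simp))
      have h := hφ.hasDerivAt_oneForm hW (θ := fderiv ℝ (pencil F₁ F₂))
        (c := 0) (t := τ * T) (x := q₀) hdiff
        (by
          filter_upwards [hO.mem_nhds (hmem τ hτ)] with q hq
          rw [hdP q hq, hW1 q hq, hW2 q hq]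
          ring) (0, w)
      have h' := h.comp τ (hmul τ)
      refine h'.congr_deriv ?_
      have hs : IsSymmSndFDerivAt ℝ (pencil F₁ F₂) (φ (τ * T) q₀) :=
        hcd.isSymmSndFDerivAt (by simpa using two_le_infty)
      rw [hs, sub_self, zero_mul]
    intro τ hτ
    have h1 := constant_of_has_deriv_right_zero
      (fun τ hτ => (hder τ hτ).continuousAt.continuousWithinAt)
      (fun τ hτ => (hder τ (Ico_subset_Icc_self hτ)).hasDerivWithinAt) τ hτ
    have h0 : φ (0 * T) q₀ = q₀ := by rw [zero_mul, hφ.zero]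
    rw [hdP _ (hmem τ hτ), hσ τ hτ, h0, hdP _ (hCO hq₀), zero_mul T, hv0] at h1
    simpa [hw] using h1
  -- the contact form on the transported vector solves a linear equation
  have hb : ∀ τ ∈ Icc (0 : ℝ) 1, A (φ (τ * T) q₀) (Complex.I • (v (τ * T)).2) = 0 := by
    set b : ℝ → ℝ := fun τ => A (φ (τ * T) q₀) (Complex.I • (v (τ * T)).2) with hbdef
    have hder : ∀ τ ∈ Icc (0 : ℝ) 1, HasDerivAt b (c (φ (τ * T) q₀) * b τ * T) τ := by
      intro τ hτ
      have hq := hmem τ hτ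
      set J := (mulI n).comp (ContinuousLinearMap.snd ℝ ℝ (CSpace n)) with hJ
      set P := (ContinuousLinearMap.compL ℝ (ℝ × CSpace n) (CSpace n) ℝ).flip J with hPdef
      have hθ : HasFDerivAt (fun q => P (A q)) (P.comp _) (φ (τ * T) q₀) :=
        P.hasFDerivAt.comp (φ (τ * T) q₀) (hdA _ hq)
      have h := hφ.hasDerivAt_oneForm hW (θ := fun q => P (A q))
        (c := 0) (t := τ * T) (x := q₀) hθ.differentiableAt
        (by filter_upwards [hO.mem_nhds hq] with q hq using hW3 q hq) (0, w)
      have h' := h.comp τ (hmul τ)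
      refine h'.congr_deriv ?_
      congr 1
      rw [hθ.fderiv]
      have h4 := hW4 _ hq _ (ha τ hτ)
      change (_ : ℝ) - _ = c (φ (τ * T) q₀) * A (φ (τ * T) q₀) (Complex.I • (v (τ * T)).2)
      rw [eq_sub_of_add_eq' h4.symm]
      have e1 : (fderiv ℝ (φ (τ * T)) q₀ (0, w)) = v (τ * T) := rfl
      simp only [hPdef, hJ, e1, ContinuousLinearMap.comp_apply, ContinuousLinearMap.flip_apply,
        ContinuousLinearMap.compL_apply, add_apply, ContinuousLinearMap.smulRight_apply,
        ContinuousLinearMap.coe_fst', ContinuousLinearMap.coe_snd', mulI_apply, hσ τ hτ,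
        hW1 _ hq, one_smul, zero_smul, zero_add, leviBilin_apply, I_smul_I_smul, map_neg,
        sub_apply]
      have hs₁ : IsSymmSndFDerivAt ℝ F₁ (φ (τ * T) q₀).2 :=
        (h₁.contDiffAt (hN.mem_nhds (hON hq).2)).isSymmSndFDerivAt (by simpa using two_le_infty)
      have hs₂ : IsSymmSndFDerivAt ℝ F₂ (φ (τ * T) q₀).2 :=
        (h₂.contDiffAt (hN.mem_nhds (hON hq).2)).isSymmSndFDerivAt (by simpa using two_le_infty)
      have hsB : ∀ x y, pencil (fderiv ℝ (fderiv ℝ F₁)) (fderiv ℝ (fderiv ℝ F₂)) (φ (τ * T) q₀) x y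
          = pencil (fderiv ℝ (fderiv ℝ F₁)) (fderiv ℝ (fderiv ℝ F₂)) (φ (τ * T) q₀) y x := by
        intro x y
        simp only [pencil, add_apply, smul_apply]
        rw [hs₁ x y, hs₂ x y]
      rw [hsB (v (τ * T)).2]
      ring
    have hcc : ContinuousOn (fun τ => c (φ (τ * T) q₀)) (Icc (0 : ℝ) 1) :=
      hc.comp (((hφ.continuous_orbit q₀).comp (by fun_prop :
        Continuous fun τ : ℝ => τ * T)).continuousOn) hmem
    obtain ⟨K, hK⟩ := isCompact_Icc.exists_bound_of_continuousOn hcc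
    refine eq_zero_of_abs_deriv_le_mul_abs_self_of_eq_zero_right (K := K * |T|)
      (fun τ hτ => (hder τ hτ).continuousAt.continuousWithinAt)
      (fun τ hτ => (hder τ (Ico_subset_Icc_self hτ)).hasDerivWithinAt) ?_ ?_
    · simp only [zero_mul, hφ.zero, hv0, hw']
    · intro τ hτ
      rw [norm_mul, norm_mul, Real.norm_eq_abs T]
      have := mul_le_mul_of_nonneg_right (hK τ (Ico_subset_Icc_self hτ))
        (mul_nonneg (norm_nonneg (b τ)) (abs_nonneg T))
      linarith
  have h1 : (1 : ℝ) ∈ Icc (0 : ℝ) 1 := ⟨zero_le_one, le_rfl⟩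
  have r1 := hσ 1 h1
  have r2 := ha 1 h1
  have r3 := hb 1 h1
  rw [one_mul] at r1 r2 r3
  exact ⟨r1, r2, r3⟩

/-- **Gray stability.** If the level sets `{(1 - s) F₁ + s F₂ = 1}`, `0 ≤ s ≤ 1`, form a compact
family of strictly pseudoconvex hypersurfaces, then the first and the last are contactomorphic. -/
theorem contactomorphic_levelSets (hN : IsOpen N) (h₁ : ContDiffOn ℝ ∞ F₁ N)
    (h₂ : ContDiffOn ℝ ∞ F₂ N) (hC : IsCompact (levelTrack F₁ F₂ N))
    (hpos : ∀ q ∈ levelTrack F₁ F₂ N, ∀ w, w ≠ 0 → 0 < leviForm F₁ q.2 w ∧ 0 < leviForm F₂ q.2 w)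
    (hdir : ∀ q ∈ levelTrack F₁ F₂ N, ∃ v, fderiv ℝ F₁ q.2 v < 0 ∧ fderiv ℝ F₂ q.2 v < 0) :
    Contactomorphic {z ∈ N | F₁ z = 1} (complexTangent F₁)
      {z ∈ N | F₂ z = 1} (complexTangent F₂) := by
  obtain ⟨O₀, Y, c, hO₀, hCO₀, hO₀N, hY, hc, hspec⟩ := exists_grayField hN h₁ h₂ hpos hdir
  obtain ⟨W, O, hW, hWc, hO, hCO, hOO₀, hWY⟩ := exists_compactlySupported_eqOn
    (V := fun q => ((1 : ℝ), Y q)) hO₀ hC hCO₀ (contDiffOn_const.prodMk hY)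
  obtain ⟨φ, hφ⟩ := exists_isSmoothFlow hW hWc
  have hON : O ⊆ univ ×ˢ N := hOO₀.trans hO₀N
  have hW1 : ∀ q ∈ O, (W q).1 = 1 := fun q hq => by rw [hWY hq]
  have hWY2 : ∀ q ∈ O, (W q).2 = Y q := fun q hq => by rw [hWY hq]
  have hW2 : ∀ q ∈ O, pencil (fderiv ℝ F₁) (fderiv ℝ F₂) q (W q).2 = -(F₂ q.2 - F₁ q.2) :=
    fun q hq => by rw [hWY2 q hq]; exact (hspec q (hOO₀ hq)).1
  have hflow := fun {q₀ : ℝ × CSpace n} (hq₀ : q₀ ∈ levelTrack F₁ F₂ N) {T : ℝ}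
      (hT : q₀.1 + T ∈ Icc (0 : ℝ) 1) =>
    flow_mem_levelTrack hN h₁ h₂ hC hO hCO hON hφ hW1 hW2 hq₀ hT 1 ⟨zero_le_one, le_rfl⟩
  have htang := fun {q₀ : ℝ × CSpace n} (hq₀ : q₀ ∈ levelTrack F₁ F₂ N) {T : ℝ}
      (hT : q₀.1 + T ∈ Icc (0 : ℝ) 1) {w : CSpace n} hw hw' =>
    fderiv_flow_mem_complexTangent hN h₁ h₂ hC hO hCO hON (hc.mono hOO₀) hW hφ hW1 hW2
      (fun q hq => by rw [hWY2 q hq]; exact (hspec q (hOO₀ hq)).2.1)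
      (fun q hq => by rw [hWY2 q hq]; exact (hspec q (hOO₀ hq)).2.2) hq₀ hT (w := w) hw hw'
  have hA0 : ∀ z, pencil (fderiv ℝ F₁) (fderiv ℝ F₂) (0, z) = fderiv ℝ F₁ z := fun z => by
    simp [pencil]
  have hA1 : ∀ z, pencil (fderiv ℝ F₁) (fderiv ℝ F₂) (1, z) = fderiv ℝ F₂ z := fun z => by
    simp [pencil]
  have hmem0 : ∀ z, z ∈ {z ∈ N | F₁ z = 1} → ((0 : ℝ), z) ∈ levelTrack F₁ F₂ N := fun z hz =>
    ⟨by simp, hz.1, by simpa [pencil] using hz.2⟩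
  have hmem1 : ∀ z, z ∈ {z ∈ N | F₂ z = 1} → ((1 : ℝ), z) ∈ levelTrack F₁ F₂ N := fun z hz =>
    ⟨by simp, hz.1, by simpa [pencil] using hz.2⟩
  have hT0 : ((0 : ℝ)) + 1 ∈ Icc (0 : ℝ) 1 := by simp
  have hT1 : ((1 : ℝ)) + (-1) ∈ Icc (0 : ℝ) 1 := by simp
  have hfwd : ∀ z ∈ {z ∈ N | F₁ z = 1}, φ 1 (0, z) = (1, (φ 1 (0, z)).2) ∧
      (φ 1 (0, z)).2 ∈ {z ∈ N | F₂ z = 1} := by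
    intro z hz
    obtain ⟨h1, h2⟩ := hflow (hmem0 z hz) hT0
    simp only [one_mul, zero_add] at h1 h2
    have h3 : φ 1 (0, z) = (1, (φ 1 (0, z)).2) := Prod.ext h2 rfl
    refine ⟨h3, h1.2.1, ?_⟩
    have h4 := h1.2.2
    rw [h3] at h4
    simpa [pencil] using h4
  have hbwd : ∀ z ∈ {z ∈ N | F₂ z = 1}, φ (-1) (1, z) = (0, (φ (-1) (1, z)).2) ∧
      (φ (-1) (1, z)).2 ∈ {z ∈ N | F₁ z = 1} := by
    intro z hz
    obtain ⟨h1, h2⟩ := hflow (hmem1 z hz) hT1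
    simp only [one_mul, add_neg_cancel] at h1 h2
    have h3 : φ (-1) (1, z) = (0, (φ (-1) (1, z)).2) := Prod.ext h2 rfl
    refine ⟨h3, h1.2.1, ?_⟩
    have h4 := h1.2.2
    rw [h3] at h4
    simpa [pencil] using h4
  have hslice : ∀ s t : ℝ, ContDiff ℝ ∞ fun z : CSpace n => (φ t (s, z)).2 := fun s t =>
    contDiff_snd.comp ((hφ.contDiff_slice t).comp (contDiff_const.prodMk contDiff_id))
  have hfd : ∀ (s t : ℝ) (z w : CSpace n), fderiv ℝ (fun z : CSpace n => (φ t (s, z)).2) z w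
      = (fderiv ℝ (φ t) (s, z) (0, w)).2 := by
    intro s t z w
    have h1 : HasFDerivAt (fun z : CSpace n => (φ t (s, z)).2)
        ((ContinuousLinearMap.snd ℝ ℝ (CSpace n)).comp
          ((fderiv ℝ (φ t) (s, z)).comp (.inr ℝ ℝ (CSpace n)))) z :=
      (ContinuousLinearMap.snd ℝ ℝ (CSpace n)).hasFDerivAt.comp z
        (((hφ.differentiable_slice t) (s, z)).hasFDerivAt.comp z (hasFDerivAt_prodMk_right s z))
    rw [h1.fderiv]
    simp
  refine ⟨fun z => (φ 1 (0, z)).2, fun z => (φ (-1) (1, z)).2,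
    ⟨univ, isOpen_univ, subset_univ _, (hslice 0 1).contDiffOn⟩,
    ⟨univ, isOpen_univ, subset_univ _, (hslice 1 (-1)).contDiffOn⟩,
    fun z hz => (hfwd z hz).2, fun z hz => (hbwd z hz).2, fun z hz => ?_, fun z hz => ?_,
    fun z hz => ?_⟩
  · change (φ (-1) (1, (φ 1 (0, z)).2)).2 = z
    rw [← (hfwd z hz).1, hφ.neg_apply]
  · change (φ 1 (0, (φ (-1) (1, z)).2)).2 = z
    rw [← (hbwd z hz).1, hφ.apply_neg]
  · set y := (φ 1 (0, z)).2 with hy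
    have hzy : φ 1 (0, z) = (1, y) := (hfwd z hz).1
    have hyz : φ (-1) (1, y) = (0, z) := by rw [← hzy, hφ.neg_apply]
    apply Subset.antisymm
    · rintro - ⟨w, ⟨hw, hw'⟩, rfl⟩
      have := htang (hmem0 z hz) hT0 (w := w) (by rw [hA0]; exact hw) (by rw [hA0]; exact hw')
      rw [hzy, hA1] at this
      rw [hfd]
      exact this.2
    · rintro u ⟨hu, hu'⟩
      have h3 := htang (hmem1 y (hfwd z hz).2) hT1 (w := u) (by rw [hA1]; exact hu)
        (by rw [hA1]; exact hu')
      rw [hyz, hA0] at h3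
      refine ⟨(fderiv ℝ (φ (-1)) (1, y) (0, u)).2, h3.2, ?_⟩
      have h4 : fderiv ℝ (φ (-1)) (1, y) (0, u)
          = (0, (fderiv ℝ (φ (-1)) (1, y) (0, u)).2) := Prod.ext h3.1 rfl
      rw [hfd, ← h4, ← hyz, hφ.fderiv_comp_fderiv_neg]

end Gray

/-! ### Orbits of a field that points inward -/

section Barrier

variable {n : ℕ} {V : Set (CSpace n)} {ρ : CSpace n → ℝ} {X : CSpace n → CSpace n}

theorem IsDefiningFunction.eq_zero_of_mem_frontier (hV : IsDefiningFunction ρ V) {z : CSpace n}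
    (hz : z ∈ frontier V) : ρ z = 0 := by
  have hc := hV.contDiff.continuous
  have h1 := frontier_lt_subset_eq hc continuous_const (hV.eq_setOf ▸ hz)
  exact h1

theorem IsDefiningFunction.isOpen (hV : IsDefiningFunction ρ V) : IsOpen V := by
  rw [hV.eq_setOf]
  exact isOpen_lt hV.contDiff.continuous continuous_const

/-- A zero of the defining function that is not a critical point lies on the boundary. -/
theorem IsDefiningFunction.mem_frontier (hV : IsDefiningFunction ρ V) {z v : CSpace n}
    (hz : ρ z = 0) (hv : fderiv ℝ ρ z v < 0) : z ∈ frontier V := by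
  rw [hV.isOpen.frontier_eq]
  refine ⟨?_, by rw [hV.eq_setOf]; simp [hz]⟩
  have hline : HasDerivAt (fun t : ℝ => z + t • v) v 0 := by
    simpa using ((hasDerivAt_id (0 : ℝ)).smul_const v).const_add z
  have hd : HasDerivAt (fun t : ℝ => ρ (z + t • v)) (fderiv ℝ ρ z v) 0 := by
    refine HasFDerivAt.comp_hasDerivAt (l := ρ) (f := fun t : ℝ => z + t • v) 0 ?_ hline
    simpa using ((hV.contDiff.differentiable (by simp)) z).hasFDerivAt
  have hev : ∀ᶠ t in 𝓝[>] (0 : ℝ), z + t • v ∈ V := by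
    have h1 := hd.hasDerivWithinAt (s := Ioi 0)
    have h2 := (hasDerivWithinAt_iff_tendsto_slope' (by simp)).1 h1
    filter_upwards [h2.eventually (gt_mem_nhds hv), self_mem_nhdsWithin] with t ht ht0
    rw [slope_def_field] at ht
    simp only [zero_smul, add_zero, hz, sub_zero] at ht
    rw [hV.eq_setOf]
    exact (div_neg_iff.1 ht).elim (fun h => absurd h.2 (not_lt.2 (le_of_lt ht0))) fun h => h.1
  have ht : Tendsto (fun t : ℝ => z + t • v) (𝓝[>] 0) (𝓝 z) := by
    have := hline.continuousAt.tendsto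
    rw [zero_smul, add_zero] at this
    exact this.mono_left nhdsWithin_le_nhds
  exact mem_closure_of_tendsto ht hev

/-- An integral curve of an inward pointing field that starts in the closure of the domain lies in
the domain at all positive times: where it would leave, the defining function decreases. -/
theorem IsDefiningFunction.integralCurve_mem (hV : IsDefiningFunction ρ V)
    (hX : PointsInward X V ρ) {γ : ℝ → CSpace n}
    (hγ : ∀ t ∈ Ici (0 : ℝ), HasDerivWithinAt γ (X (γ t)) (Ici 0) t)
    (h0 : γ 0 ∈ closure V) {t : ℝ} (ht : 0 < t) : γ t ∈ V := by
  have hder : ∀ t ∈ Ici (0 : ℝ),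
      HasDerivWithinAt (fun t => ρ (γ t)) (fderiv ℝ ρ (γ t) (X (γ t))) (Ici 0) t := fun t ht =>
    ((hV.contDiff.differentiable (by simp)) (γ t)).hasFDerivAt.comp_hasDerivWithinAt t (hγ t ht)
  have hmemV : ∀ z, z ∈ V ↔ ρ z < 0 := fun z => by
    conv_lhs => rw [hV.eq_setOf]
    rfl
  obtain ⟨t₀, ht₀, ht₀t, hmem₀⟩ : ∃ t₀, 0 ≤ t₀ ∧ t₀ < t ∧ ρ (γ t₀) < 0 := by
    by_cases h : γ 0 ∈ V
    · exact ⟨0, le_rfl, ht, (hmemV _).1 h⟩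
    have hfr : γ 0 ∈ frontier V := by
      rw [hV.isOpen.frontier_eq]
      exact ⟨h0, h⟩
    have h1 := (hder 0 (mem_Ici.2 le_rfl)).mono Ioi_subset_Ici_self
    have h2 := (hasDerivWithinAt_iff_tendsto_slope' (by simp)).1 h1
    obtain ⟨s, hs1, hs2, hs3⟩ := ((h2.eventually (gt_mem_nhds (hX _ hfr))).and
      (Ioo_mem_nhdsGT ht)).exists
    rw [slope_def_field, hV.eq_zero_of_mem_frontier hfr, sub_zero, sub_zero] at hs1
    exact ⟨s, hs2.le, hs3,
      (div_neg_iff.1 hs1).elim (fun h => absurd h.2 (not_lt.2 hs2.le)) fun h => h.1⟩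
  by_contra hnot
  rw [hmemV, not_lt] at hnot
  have hcont : ContinuousOn (fun t => ρ (γ t)) (Icc t₀ t) := fun s hs =>
    ((hder s (ht₀.trans hs.1)).continuousWithinAt).mono fun r hr => ht₀.trans hr.1
  have hcomp : IsCompact (Icc t₀ t ∩ (fun t => ρ (γ t)) ⁻¹' Ici 0) :=
    isCompact_Icc.of_isClosed_subset (hcont.preimage_isClosed_of_isClosed isClosed_Icc isClosed_Ici)
      inter_subset_left
  obtain ⟨s, ⟨hs, hs0⟩, hleast⟩ := hcomp.exists_isLeast ⟨t, ⟨ht₀t.le, le_rfl⟩, hnot⟩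
  have hs0' : 0 ≤ ρ (γ s) := hs0
  have hst : t₀ < s := lt_of_le_of_ne hs.1 fun h => by rw [h] at hmem₀; linarith
  have hs_pos : 0 < s := lt_of_le_of_lt ht₀ hst
  have hbefore : ∀ r ∈ Ioo t₀ s, ρ (γ r) < 0 := fun r hr => by
    by_contra h
    exact absurd (hleast ⟨⟨hr.1.le, hr.2.le.trans hs.2⟩, not_lt.1 h⟩) (not_le.2 hr.2)
  have hsat : HasDerivAt (fun t => ρ (γ t)) (fderiv ℝ ρ (γ s) (X (γ s))) s :=
    (hder s hs_pos.le).hasDerivAt (Ici_mem_nhds hs_pos)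
  have hγs : ContinuousAt γ s := ((hγ s hs_pos.le).hasDerivAt (Ici_mem_nhds hs_pos)).continuousAt
  have hIoo : Ioo t₀ s ∈ 𝓝[<] s := Ioo_mem_nhdsLT hst
  have hfr : γ s ∈ frontier V := by
    rw [hV.isOpen.frontier_eq]
    refine ⟨mem_closure_of_tendsto (hγs.tendsto.mono_left (nhdsWithin_le_nhds (s := Iio s))) ?_,
      fun h => absurd ((hmemV _).1 h) (not_lt.2 hs0')⟩
    filter_upwards [hIoo] with r hr using (hmemV _).2 (hbefore r hr)
  have h2 := (hasDerivWithinAt_iff_tendsto_slope' (by simp)).1 (hsat.hasDerivWithinAt (s := Iio s))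
  obtain ⟨r, hr1, hr2⟩ := ((h2.eventually (gt_mem_nhds (hX _ hfr))).and hIoo).exists
  rw [slope_def_field, hV.eq_zero_of_mem_frontier hfr, sub_zero] at hr1
  have := div_pos_of_neg_of_neg (hbefore r hr2) (sub_neg.2 hr2.2)
  linarith

end Barrier

/-! ### Hitting times -/

section HittingTime

variable {n : ℕ} {V : Set (CSpace n)} {ρ : CSpace n → ℝ} {X : CSpace n → CSpace n}
  {φ : ℝ → CSpace n → CSpace n}

/-- The points whose orbit meets the boundary of `V`. -/
def hitSet (φ : ℝ → CSpace n → CSpace n) (V : Set (CSpace n)) : Set (CSpace n) :=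
  {z | ∃ t, φ t z ∈ frontier V}

/-- The time at which the orbit of `z` meets the boundary of `V`; it has no meaning outside of
`hitSet φ V`. -/
noncomputable def hitTime (φ : ℝ → CSpace n → CSpace n) (V : Set (CSpace n)) (z : CSpace n) : ℝ :=
  Classical.epsilon fun t => φ t z ∈ frontier V

theorem flow_hitTime_mem {z : CSpace n} (hz : z ∈ hitSet φ V) :
    φ (hitTime φ V z) z ∈ frontier V :=
  Classical.epsilon_spec hz

/-- The standing assumptions on a domain and a flow: the domain has a smooth defining function, and
the generating field points inward along the boundary. -/
structure IsInwardFlow (V : Set (CSpace n)) (ρ : CSpace n → ℝ) (X : CSpace n → CSpace n)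
    (φ : ℝ → CSpace n → CSpace n) : Prop where
  isDefiningFunction : IsDefiningFunction ρ V
  contDiff : ContDiff ℝ ∞ X
  isSmoothFlow : IsSmoothFlow X φ
  pointsInward : PointsInward X V ρ

namespace IsInwardFlow

theorem flow_mem (h : IsInwardFlow V ρ X φ) {z : CSpace n} (hz : z ∈ closure V) {t : ℝ}
    (ht : 0 < t) : φ t z ∈ V :=
  h.isDefiningFunction.integralCurve_mem h.pointsInward (γ := fun t => φ t z)
    (fun t _ => (h.isSmoothFlow.hasDerivAt t z).hasDerivWithinAt)
    (by simpa [h.isSmoothFlow.zero] using hz) ht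

theorem flow_mem_closure (h : IsInwardFlow V ρ X φ) {z : CSpace n} (hz : z ∈ closure V) {t : ℝ}
    (ht : 0 ≤ t) : φ t z ∈ closure V := by
  rcases ht.eq_or_lt with rfl | ht
  · rwa [h.isSmoothFlow.zero]
  · exact subset_closure (h.flow_mem hz ht)

theorem notMem_of_mem_frontier (h : IsInwardFlow V ρ X φ) {z : CSpace n} (hz : z ∈ frontier V) :
    z ∉ V := by
  rw [h.isDefiningFunction.isOpen.frontier_eq] at hz
  exact hz.2

theorem le_of_mem_frontier (h : IsInwardFlow V ρ X φ) {z : CSpace n} {s t : ℝ}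
    (hs : φ s z ∈ closure V) (ht : φ t z ∈ frontier V) : t ≤ s := by
  by_contra! hst
  have h1 := h.flow_mem hs (sub_pos.2 hst)
  rw [← h.isSmoothFlow.add, sub_add_cancel] at h1
  exact h.notMem_of_mem_frontier ht h1

theorem hitTime_eq (h : IsInwardFlow V ρ X φ) {z : CSpace n} {t : ℝ} (ht : φ t z ∈ frontier V) :
    hitTime φ V z = t := by
  have h1 := flow_hitTime_mem (φ := φ) (V := V) ⟨t, ht⟩
  exact le_antisymm (h.le_of_mem_frontier (frontier_subset_closure ht) h1)
    (h.le_of_mem_frontier (frontier_subset_closure h1) ht)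

theorem mem_hitSet_of_frontier (h : IsInwardFlow V ρ X φ) {z : CSpace n} (hz : z ∈ frontier V) :
    z ∈ hitSet φ V := ⟨0, by rwa [h.isSmoothFlow.zero]⟩

theorem hitTime_of_frontier (h : IsInwardFlow V ρ X φ) {z : CSpace n} (hz : z ∈ frontier V) :
    hitTime φ V z = 0 := h.hitTime_eq (by rwa [h.isSmoothFlow.zero])

theorem hitTime_flow (h : IsInwardFlow V ρ X φ) {z : CSpace n} (hz : z ∈ hitSet φ V) (s : ℝ) :
    hitTime φ V (φ s z) = hitTime φ V z - s := by
  refine h.hitTime_eq ?_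
  rw [← h.isSmoothFlow.add, sub_add_cancel]
  exact flow_hitTime_mem hz

theorem hitTime_neg (h : IsInwardFlow V ρ X φ) {z : CSpace n} (hz : z ∈ hitSet φ V)
    (hzV : z ∈ V) : hitTime φ V z < 0 := by
  by_contra! hle
  exact h.notMem_of_mem_frontier (flow_hitTime_mem hz)
    (hle.eq_or_lt.elim (fun h0 => by rwa [← h0, h.isSmoothFlow.zero])
      fun hlt => h.flow_mem (subset_closure hzV) hlt)

theorem hitTime_pos (h : IsInwardFlow V ρ X φ) {z : CSpace n} (hz : z ∈ hitSet φ V)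
    (hzV : z ∉ closure V) : 0 < hitTime φ V z := by
  by_contra! hle
  apply hzV
  have h1 := h.flow_mem_closure (frontier_subset_closure (flow_hitTime_mem hz)) (neg_nonneg.2 hle)
  rwa [h.isSmoothFlow.neg_apply] at h1

/-- The hitting time is locally given by the implicit function theorem, because the defining
function has a nonzero derivative along the field. -/
theorem eventually_hitTime (h : IsInwardFlow V ρ X φ) {z₀ : CSpace n} (hz₀ : z₀ ∈ hitSet φ V) :
    (∀ᶠ z in 𝓝 z₀, z ∈ hitSet φ V) ∧ ContDiffAt ℝ ∞ (hitTime φ V) z₀ := by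
  obtain ⟨t₀, ht₀⟩ := hz₀
  set g : CSpace n × ℝ → ℝ := fun q => ρ (φ q.2 q.1) with hg
  have hgs : ContDiff ℝ ∞ g := h.isDefiningFunction.contDiff.comp
    (h.isSmoothFlow.contDiff.comp (contDiff_snd.prodMk contDiff_fst))
  have hcd : ContDiffAt ℝ ∞ g (z₀, t₀) := hgs.contDiffAt
  have hpn : (∞ : WithTop ℕ∞) ≠ 0 := by simp
  set a := fderiv ℝ ρ (φ t₀ z₀) (X (φ t₀ z₀)) with ha
  have ha0 : a ≠ 0 := (h.pointsInward _ ht₀).ne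
  have hD : fderiv ℝ g (z₀, t₀) ∘L .inr ℝ (CSpace n) ℝ
      = ContinuousLinearMap.toSpanSingleton ℝ a := by
    have h1 : HasFDerivAt (fun t => g (z₀, t))
        (fderiv ℝ g (z₀, t₀) ∘L .inr ℝ (CSpace n) ℝ) t₀ :=
      (((hgs.differentiable (by simp)) (z₀, t₀)).hasFDerivAt).comp t₀
        (hasFDerivAt_prodMk_right z₀ t₀)
    have h2 : HasDerivAt (fun t => g (z₀, t)) a t₀ :=
      ((h.isDefiningFunction.contDiff.differentiable (by simp)) (φ t₀ z₀)).hasFDerivAt.comp_hasDerivAt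
        t₀ (h.isSmoothFlow.hasDerivAt t₀ z₀)
    exact h1.unique h2.hasFDerivAt
  have hinv : (fderiv ℝ g (z₀, t₀) ∘L .inr ℝ (CSpace n) ℝ).IsInvertible := by
    rw [hD]
    refine ⟨ContinuousLinearEquiv.unitsEquivAut ℝ (Units.mk0 a ha0), ?_⟩
    ext
    simp
  set ψ := hcd.implicitFunction hpn hinv with hψ
  have hψs : ContDiffAt ℝ ∞ ψ z₀ := hcd.contDiffAt_implicitFunction hpn hinv
  have hψ0 : ψ z₀ = t₀ := hcd.implicitFunction_apply_self hpn hinv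
  have hev := hcd.eventually_apply_implicitFunction hpn hinv
  have hneg : ∀ᶠ z in 𝓝 z₀, fderiv ℝ ρ (φ (ψ z) z) (X (φ (ψ z) z)) < 0 := by
    have hc1 : Continuous fun y => fderiv ℝ ρ y (X y) :=
      (h.isDefiningFunction.contDiff.continuous_fderiv (by simp)).clm_apply h.contDiff.continuous
    have hc2 : ContinuousAt (fun z => φ (ψ z) z) z₀ :=
      ContinuousAt.comp (f := fun z => (ψ z, z)) (g := fun q : ℝ × CSpace n => φ q.1 q.2)
        h.isSmoothFlow.contDiff.continuous.continuousAt (hψs.continuousAt.prodMk continuousAt_id)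
    have hc3 := hc1.continuousAt.comp hc2
    refine hc3.eventually (gt_mem_nhds ?_)
    simp only [Function.comp_apply, hψ0]
    exact h.pointsInward _ ht₀
  have hfr : ∀ᶠ z in 𝓝 z₀, φ (ψ z) z ∈ frontier V := by
    filter_upwards [hev, hneg] with z hz1 hz2
    refine h.isDefiningFunction.mem_frontier ?_ hz2
    have : g (z, ψ z) = g (z₀, t₀) := hz1
    simp only [hg] at this
    rw [this, h.isDefiningFunction.eq_zero_of_mem_frontier ht₀]
  refine ⟨hfr.mono fun z hz => ⟨_, hz⟩, hψs.congr_of_eventuallyEq ?_⟩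
  exact hfr.mono fun z hz => h.hitTime_eq hz

theorem isOpen_hitSet (h : IsInwardFlow V ρ X φ) : IsOpen (hitSet φ V) :=
  isOpen_iff_mem_nhds.2 fun _ hz => (h.eventually_hitTime hz).1

theorem contDiffOn_hitTime (h : IsInwardFlow V ρ X φ) :
    ContDiffOn ℝ ∞ (hitTime φ V) (hitSet φ V) :=
  fun _ hz => (h.eventually_hitTime hz).2.contDiffWithinAt

theorem fderiv_hitTime_field (h : IsInwardFlow V ρ X φ) {z : CSpace n} (hz : z ∈ hitSet φ V) :
    fderiv ℝ (hitTime φ V) z (X z) = -1 := by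
  have h1 : HasDerivAt (fun t => hitTime φ V (φ t z)) (fderiv ℝ (hitTime φ V) z (X z)) 0 := by
    have hd := h.isSmoothFlow.hasDerivAt 0 z
    rw [h.isSmoothFlow.zero] at hd
    refine HasFDerivAt.comp_hasDerivAt (l := hitTime φ V) 0 ?_ hd
    rw [h.isSmoothFlow.zero]
    exact ((h.eventually_hitTime hz).2.differentiableAt (by simp)).hasFDerivAt
  have h2 : HasDerivAt (fun t => hitTime φ V (φ t z)) (-1) 0 := by
    simp only [h.hitTime_flow hz]
    exact (hasDerivAt_id 0).const_sub _
  exact h1.unique h2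

end IsInwardFlow

end HittingTime

/-! ### Second derivatives of compositions and holomorphic changes of variables -/

section SecondDerivative

variable {E G : Type*} [NormedAddCommGroup E] [NormedSpace ℝ E]
  [NormedAddCommGroup G] [NormedSpace ℝ G]

theorem eventually_differentiableAt {f : E → G} {z : E} (hf : ContDiffAt ℝ ∞ f z) :
    ∀ᶠ y in 𝓝 z, DifferentiableAt ℝ f y :=
  ((hf.of_le (m := 1) (by simp)).eventually (by simp)).mono fun _ hy =>
    hy.differentiableAt one_ne_zero

theorem differentiableAt_fderiv {f : E → G} {z : E} (hf : ContDiffAt ℝ ∞ f z) :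
    DifferentiableAt ℝ (fderiv ℝ f) z :=
  (hf.fderiv_right (m := ∞) (by simp)).differentiableAt (by simp)

/-- The chain rule for second derivatives. -/
theorem fderiv_fderiv_comp {f : G → ℝ} {h : E → G} {z : E} (hf : ContDiffAt ℝ ∞ f (h z))
    (hh : ContDiffAt ℝ ∞ h z) (u v : E) :
    fderiv ℝ (fderiv ℝ (fun y => f (h y))) z u v
      = fderiv ℝ (fderiv ℝ f) (h z) (fderiv ℝ h z u) (fderiv ℝ h z v)
        + fderiv ℝ f (h z) (fderiv ℝ (fderiv ℝ h) z u v) := by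
  have h1 : fderiv ℝ (fun y => f (h y)) =ᶠ[𝓝 z] fun y => (fderiv ℝ f (h y)).comp (fderiv ℝ h y) := by
    filter_upwards [hh.continuousAt.eventually (eventually_differentiableAt hf),
      eventually_differentiableAt hh] with y hy1 hy2
    exact (hy1.hasFDerivAt.comp y hy2.hasFDerivAt).fderiv
  have h2 : HasFDerivAt (fun y => fderiv ℝ f (h y))
      ((fderiv ℝ (fderiv ℝ f) (h z)).comp (fderiv ℝ h z)) z :=
    (differentiableAt_fderiv hf).hasFDerivAt.comp z (hh.differentiableAt (by simp)).hasFDerivAt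
  have h3 := h2.clm_comp (differentiableAt_fderiv hh).hasFDerivAt
  rw [h1.fderiv_eq, h3.fderiv]
  simp only [add_apply, ContinuousLinearMap.comp_apply, ContinuousLinearMap.compL_apply,
    ContinuousLinearMap.flip_apply]
  rw [add_comm]

variable {n : ℕ}

/-- The Levi form is covariant under changes of variables that are holomorphic near the point. -/
theorem leviForm_comp {f : CSpace n → ℝ} {h : CSpace n → CSpace n} {z : CSpace n}
    (hf : ContDiffAt ℝ ∞ f (h z)) (hh : ContDiffAt ℝ ∞ h z)
    (hhol : ∀ᶠ y in 𝓝 z, ∀ w, fderiv ℝ h y (Complex.I • w) = Complex.I • fderiv ℝ h y w)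
    (w : CSpace n) :
    leviForm (fun y => f (h y)) z w = leviForm f (h z) (fderiv ℝ h z w) := by
  have hI : ∀ u v, fderiv ℝ (fderiv ℝ h) z u (Complex.I • v)
      = Complex.I • fderiv ℝ (fderiv ℝ h) z u v := by
    intro u v
    have hd := (differentiableAt_fderiv hh).hasFDerivAt
    have h1 : HasFDerivAt (fun y => fderiv ℝ h y (Complex.I • v))
        ((fderiv ℝ (fderiv ℝ h) z).flip (Complex.I • v)) z :=
      (ContinuousLinearMap.apply ℝ (CSpace n) (Complex.I • v)).hasFDerivAt.comp z hd
    have h2 : HasFDerivAt (fun y => Complex.I • fderiv ℝ h y v)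
        ((mulI n).comp ((fderiv ℝ (fderiv ℝ h) z).flip v)) z :=
      (mulI n).hasFDerivAt.comp z
        ((ContinuousLinearMap.apply ℝ (CSpace n) v).hasFDerivAt.comp z hd)
    have h3 := h1.unique (h2.congr_of_eventuallyEq (hhol.mono fun y hy => hy v))
    exact congrArg (fun A : CSpace n →L[ℝ] CSpace n => A u) h3
  have hs : IsSymmSndFDerivAt ℝ h z := hh.isSymmSndFDerivAt (by simpa using two_le_infty)
  have hII : fderiv ℝ (fderiv ℝ h) z (Complex.I • w) (Complex.I • w)
      = -fderiv ℝ (fderiv ℝ h) z w w := by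
    rw [hI, hs, hI, I_smul_I_smul]
  unfold leviForm
  rw [fderiv_fderiv_comp hf hh, fderiv_fderiv_comp hf hh, hII, hhol.self_of_nhds w, map_neg]
  ring

theorem leviForm_congr {f g : CSpace n → ℝ} {z : CSpace n} (h : f =ᶠ[𝓝 z] g) (w : CSpace n) :
    leviForm f z w = leviForm g z w := by
  unfold leviForm
  rw [h.fderiv.fderiv_eq]

theorem leviForm_const_mul {f : CSpace n → ℝ} {z : CSpace n} (hf : ContDiffAt ℝ ∞ f z) (c : ℝ)
    (w : CSpace n) : leviForm (fun y => c * f y) z w = c * leviForm f z w := by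
  have h1 : fderiv ℝ (fun y => c * f y) =ᶠ[𝓝 z] fun y => c • fderiv ℝ f y := by
    filter_upwards [eventually_differentiableAt hf] with y hy
    exact (hy.hasFDerivAt.const_mul c).fderiv
  have h2 : HasFDerivAt (fun y => c • fderiv ℝ f y) (c • fderiv ℝ (fderiv ℝ f) z) z :=
    (differentiableAt_fderiv hf).hasFDerivAt.const_smul c
  unfold leviForm
  rw [h1.fderiv_eq, h2.fderiv]
  simp only [smul_apply, smul_eq_mul]
  ring

theorem leviForm_smul (f : CSpace n → ℝ) (z : CSpace n) (c : ℝ) (w : CSpace n) :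
    leviForm f z (c • w) = c ^ 2 * leviForm f z w := by
  unfold leviForm
  rw [smul_comm Complex.I c w]
  simp only [map_smul, smul_apply, smul_eq_mul]
  ring

theorem fderiv_exp_mul {τ : CSpace n → ℝ} {z : CSpace n} (hτ : DifferentiableAt ℝ τ z) (l : ℝ) :
    fderiv ℝ (fun y => Real.exp (l * τ y)) z = (l * Real.exp (l * τ z)) • fderiv ℝ τ z := by
  rw [((hτ.hasFDerivAt.const_mul l).exp).fderiv, smul_smul, mul_comm]

/-- The Levi form of `exp (l τ)`: the square of `∂τ` enters with the factor `l`. -/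
theorem leviForm_exp_mul {τ : CSpace n → ℝ} {z : CSpace n} (hτ : ContDiffAt ℝ ∞ τ z) (l : ℝ)
    (w : CSpace n) :
    leviForm (fun y => Real.exp (l * τ y)) z w = l * Real.exp (l * τ z) / 4 *
      (l * (fderiv ℝ τ z w ^ 2 + fderiv ℝ τ z (Complex.I • w) ^ 2) + 4 * leviForm τ z w) := by
  have h1 : fderiv ℝ (fun y => Real.exp (l * τ y))
      =ᶠ[𝓝 z] fun y => (l * Real.exp (l * τ y)) • fderiv ℝ τ y :=
    (eventually_differentiableAt hτ).mono fun y hy => fderiv_exp_mul hy l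
  have h2 : HasFDerivAt (fun y => l * Real.exp (l * τ y))
      (l • (l * Real.exp (l * τ z)) • fderiv ℝ τ z) z := by
    have hd := (hτ.differentiableAt (by simp)).hasFDerivAt
    have := ((hd.const_mul l).exp).const_mul l
    rw [smul_smul (Real.exp _) l, mul_comm (Real.exp _) l] at this
    exact this
  have h3 : HasFDerivAt (fun y => (l * Real.exp (l * τ y)) • fderiv ℝ τ y)
      ((l * Real.exp (l * τ z)) • fderiv ℝ (fderiv ℝ τ) z
        + (l • (l * Real.exp (l * τ z)) • fderiv ℝ τ z).smulRight (fderiv ℝ τ z)) z :=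
    h2.smul (differentiableAt_fderiv hτ).hasFDerivAt
  unfold leviForm
  rw [h1.fderiv_eq, h3.fderiv]
  simp only [add_apply, smul_apply, ContinuousLinearMap.smulRight_apply, smul_eq_mul]
  ring

end SecondDerivative

/-! ### Holomorphy of the flow -/

section HolomorphicFlow

variable {n : ℕ} {X : CSpace n → CSpace n} {φ : ℝ → CSpace n → CSpace n}

/-- The flow of a field is holomorphic along orbits that stay where the field is holomorphic. -/
theorem IsSmoothFlow.fderiv_I_smul (hφ : IsSmoothFlow X φ) (hX : ContDiff ℝ ∞ X)
    {O : Set (CSpace n)} (hO : IsOpen O) (hXO : DifferentiableOn ℂ X O) {T : ℝ} {y : CSpace n}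
    (hy : ∀ s ∈ Icc (0 : ℝ) 1, φ (s * T) y ∈ O) (w : CSpace n) :
    fderiv ℝ (φ T) y (Complex.I • w) = Complex.I • fderiv ℝ (φ T) y w := by
  set e : ℝ → CSpace n := fun s =>
    fderiv ℝ (φ (s * T)) y (Complex.I • w) - Complex.I • fderiv ℝ (φ (s * T)) y w with he
  have hXI : ∀ x ∈ O, ∀ v, fderiv ℝ X x (Complex.I • v) = Complex.I • fderiv ℝ X x v := by
    intro x hx v
    have := (hXO.differentiableAt (hO.mem_nhds hx)).fderiv_restrictScalars ℝ
    rw [this]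
    simp
  have hder : ∀ s ∈ Icc (0 : ℝ) 1,
      HasDerivAt e (T • fderiv ℝ X (φ (s * T) y) (e s)) s := by
    intro s hs
    have hmul : HasDerivAt (fun s : ℝ => s * T) T s := by
      simpa using (hasDerivAt_id s).mul_const T
    have h1 : ∀ v, HasDerivAt (fun s : ℝ => fderiv ℝ (φ (s * T)) y v)
        (T • fderiv ℝ X (φ (s * T) y) (fderiv ℝ (φ (s * T)) y v)) s := fun v =>
      HasDerivAt.scomp (g₁ := fun t => fderiv ℝ (φ t) y v) s
        (hφ.hasDerivAt_fderiv hX (s * T) y v) hmul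
    have h2 : HasDerivAt (fun s : ℝ => Complex.I • fderiv ℝ (φ (s * T)) y w)
        (Complex.I • (T • fderiv ℝ X (φ (s * T) y) (fderiv ℝ (φ (s * T)) y w))) s :=
      (mulI n).hasFDerivAt.comp_hasDerivAt s (h1 w)
    refine ((h1 (Complex.I • w)).sub h2).congr_deriv ?_
    rw [smul_comm Complex.I T, ← hXI _ (hy s hs), ← smul_sub, ← map_sub]
  have hK : ContinuousOn (fun s => fderiv ℝ X (φ (s * T) y)) (Icc (0 : ℝ) 1) :=
    ((hX.continuous_fderiv (by simp)).comp ((hφ.continuous_orbit y).comp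
      (by fun_prop : Continuous fun s : ℝ => s * T))).continuousOn
  obtain ⟨K, hK⟩ := isCompact_Icc.exists_bound_of_continuousOn hK
  have hzero := eq_zero_of_abs_deriv_le_mul_abs_self_of_eq_zero_right (K := |T| * K)
    (fun s hs => (hder s hs).continuousAt.continuousWithinAt)
    (fun s hs => (hder s (Ico_subset_Icc_self hs)).hasDerivWithinAt)
    (by
      have : φ 0 = id := funext hφ.zero
      simp [he, this])
    (fun s hs => by
      rw [norm_smul, Real.norm_eq_abs, mul_assoc]
      exact mul_le_mul_of_nonneg_left
        (ContinuousLinearMap.le_of_opNorm_le _ (hK s (Ico_subset_Icc_self hs)) _) (abs_nonneg _))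
    1 ⟨zero_le_one, le_rfl⟩
  simpa [he, sub_eq_zero] using hzero

theorem IsSmoothFlow.eventually_segment_mem (hφ : IsSmoothFlow X φ)
    {O : Set (CSpace n)} (hO : IsOpen O) {T : ℝ} {z : CSpace n}
    (hz : ∀ s ∈ Icc (0 : ℝ) 1, φ (s * T) z ∈ O) :
    ∀ᶠ y in 𝓝 z, ∀ s ∈ Icc (0 : ℝ) 1, φ (s * T) y ∈ O := by
  refine isCompact_Icc.eventually_forall_of_forall_eventually fun s hs => ?_
  have hc : Continuous fun q : CSpace n × ℝ => φ (q.2 * T) q.1 :=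
    hφ.contDiff.continuous.comp (by fun_prop : Continuous fun q : CSpace n × ℝ => (q.2 * T, q.1))
  exact hc.continuousAt.eventually (hO.mem_nhds (hz s hs))

end HolomorphicFlow

/-! ### Strictly plurisubharmonic exponentials of hitting times -/

section Psh

/-- If `b > 0` on the zero set of `a ≥ 0` in a compact set, then `l a + b > 0` for large `l`. -/
theorem exists_mul_add_pos {α : Type*} [TopologicalSpace α] {K : Set α} (hK : IsCompact K)
    {a b : α → ℝ} (ha : ContinuousOn a K) (hb : ContinuousOn b K) (ha0 : ∀ x ∈ K, 0 ≤ a x)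
    (hab : ∀ x ∈ K, a x = 0 → 0 < b x) : ∃ l : ℝ, 0 < l ∧ ∀ x ∈ K, 0 < l * a x + b x := by
  rcases K.eq_empty_or_nonempty with rfl | hne
  · exact ⟨1, one_pos, by simp⟩
  -- the ratio `b⁻ / (a + b⁺)` of continuous functions is bounded by some `l`
  have hden : ∀ x ∈ K, 0 < a x + max (b x) 0 := by
    intro x hx
    rcases (ha0 x hx).eq_or_lt with h | h
    · have := hab x hx h.symm
      rw [← h, max_eq_left this.le]
      linarith
    · have := le_max_right (b x) 0
      linarith
  have hcont : ContinuousOn (fun x => max (-b x) 0 / (a x + max (b x) 0)) K :=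
    (hb.neg.sup continuousOn_const).div (ha.add (hb.sup continuousOn_const))
      fun x hx => (hden x hx).ne'
  obtain ⟨M, hM⟩ := hK.exists_bound_of_continuousOn hcont
  refine ⟨|M| + 1, by positivity, fun x hx => ?_⟩
  by_cases hbx : 0 < b x
  · have := mul_nonneg (by positivity : 0 ≤ |M| + 1) (ha0 x hx)
    linarith
  · have hbx' : b x ≤ 0 := not_lt.1 hbx
    have h1 := hM x hx
    have h2 := hden x hx
    rw [max_eq_right hbx', add_zero] at h1 h2
    rw [max_eq_left (neg_nonneg.2 hbx')] at h1
    have h3 : -b x / a x ≤ |M| := (le_abs_self _).trans (h1.trans (le_abs_self M))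
    rw [div_le_iff₀ h2] at h3
    nlinarith

variable {n : ℕ} {V : Set (CSpace n)} {ρ : CSpace n → ℝ} {X : CSpace n → CSpace n}
  {φ : ℝ → CSpace n → CSpace n}

namespace IsInwardFlow

theorem contDiffAt_hitTime (h : IsInwardFlow V ρ X φ) {z : CSpace n} (hz : z ∈ hitSet φ V) :
    ContDiffAt ℝ ∞ (hitTime φ V) z := (h.eventually_hitTime hz).2

/-- The projection along the flow onto the boundary, to second order at a boundary point: its
derivative, and the fact that it annihilates both `ρ` and the hitting time. -/
theorem exists_projection (h : IsInwardFlow V ρ X φ) {q : CSpace n} (hq : q ∈ frontier V) :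
    ∃ P : CSpace n → CSpace n, ContDiffAt ℝ ∞ P q ∧ P q = q ∧
      (∀ w, fderiv ℝ P q w = w + fderiv ℝ (hitTime φ V) q w • X q) ∧
      (∀ᶠ y in 𝓝 q, ρ (P y) = 0) ∧ (∀ᶠ y in 𝓝 q, hitTime φ V (P y) = 0) := by
  have hqh := h.mem_hitSet_of_frontier hq
  have h0 := h.hitTime_of_frontier hq
  have hτ := h.contDiffAt_hitTime hqh
  have hev := (h.eventually_hitTime hqh).1
  have hpair : ContDiffAt ℝ ∞ (fun y => (hitTime φ V y, y)) q := hτ.prodMk contDiffAt_id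
  refine ⟨fun y => φ (hitTime φ V y) y, ?_, ?_, fun w => ?_, ?_, ?_⟩
  · exact h.isSmoothFlow.contDiff.contDiffAt.comp q hpair
  · simp [h0, h.isSmoothFlow.zero]
  · have hd := (h.isSmoothFlow.contDiff.differentiable (by simp)) (hitTime φ V q, q)
    have hp : HasFDerivAt (fun y => (hitTime φ V y, y))
        ((fderiv ℝ (hitTime φ V) q).prod (ContinuousLinearMap.id ℝ (CSpace n))) q :=
      (hτ.differentiableAt (by simp)).hasFDerivAt.prodMk (hasFDerivAt_id q)
    set f : ℝ × CSpace n → CSpace n := fun r => φ r.1 r.2 with hf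
    have hcomp : HasFDerivAt (fun y => φ (hitTime φ V y) y) _ q :=
      HasFDerivAt.comp (g := f) (f := fun y => (hitTime φ V y, y)) q hd.hasFDerivAt hp
    have e1 : fderiv ℝ f (0, q) (1, 0) = X q := by
      have h1 : HasDerivAt (fun t : ℝ => (t, q)) ((1 : ℝ), (0 : CSpace n)) 0 :=
        (hasDerivAt_id (0 : ℝ)).prodMk (hasDerivAt_const (0 : ℝ) q)
      rw [h0] at hd
      have h2 : HasDerivAt (fun t => φ t q) (fderiv ℝ f (0, q) (1, 0)) 0 :=
        HasFDerivAt.comp_hasDerivAt (l := f) 0 hd.hasFDerivAt h1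
      have h3 := h2.unique (h.isSmoothFlow.hasDerivAt 0 q)
      rwa [h.isSmoothFlow.zero] at h3
    have e2 : fderiv ℝ f (0, q) (0, w) = w := by
      rw [h0] at hd
      have h2 : HasFDerivAt (φ 0) (fderiv ℝ f (0, q) ∘L .inr ℝ ℝ (CSpace n)) q :=
        HasFDerivAt.comp (g := f) q hd.hasFDerivAt (hasFDerivAt_prodMk_right (0 : ℝ) q)
      have h3 : HasFDerivAt (φ 0) (ContinuousLinearMap.id ℝ (CSpace n)) q := by
        have : φ 0 = id := funext h.isSmoothFlow.zero
        rw [this]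
        exact hasFDerivAt_id q
      have h4 := congrArg (fun A : CSpace n →L[ℝ] CSpace n => A w) (h2.unique h3)
      simpa using h4
    rw [hcomp.fderiv, ContinuousLinearMap.comp_apply, ContinuousLinearMap.prod_apply, h0]
    have e3 : ((fderiv ℝ (hitTime φ V) q w, ContinuousLinearMap.id ℝ (CSpace n) w) :
        ℝ × CSpace n) = fderiv ℝ (hitTime φ V) q w • ((1 : ℝ), (0 : CSpace n)) + (0, w) := by
      simp
    rw [e3, map_add, map_smul, e1, e2, add_comm]
  · exact hev.mono fun y hy =>
      h.isDefiningFunction.eq_zero_of_mem_frontier (flow_hitTime_mem hy)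
  · exact hev.mono fun y hy => h.hitTime_of_frontier (flow_hitTime_mem hy)

/-- On the boundary, the hitting time is a defining function to first order. -/
theorem fderiv_hitTime (h : IsInwardFlow V ρ X φ) {q : CSpace n} (hq : q ∈ frontier V)
    (w : CSpace n) :
    fderiv ℝ ρ q w = -fderiv ℝ ρ q (X q) * fderiv ℝ (hitTime φ V) q w := by
  obtain ⟨P, hP, hPq, hdP, hρP, -⟩ := h.exists_projection hq
  have h1 : HasFDerivAt (fun y => ρ (P y)) ((fderiv ℝ ρ (P q)).comp (fderiv ℝ P q)) q :=
    ((h.isDefiningFunction.contDiff.differentiable (by simp)) (P q)).hasFDerivAt.comp q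
      (hP.differentiableAt (by simp)).hasFDerivAt
  have h2 : HasFDerivAt (fun y => ρ (P y)) (0 : CSpace n →L[ℝ] ℝ) q :=
    (hasFDerivAt_const (0 : ℝ) q).congr_of_eventuallyEq hρP
  have h3 := congrArg (fun A : CSpace n →L[ℝ] ℝ => A w) (h1.unique h2)
  simp only [ContinuousLinearMap.comp_apply, hPq, hdP, map_add, map_smul, smul_eq_mul,
    zero_apply] at h3
  linarith

theorem mem_complexTangent_hitTime (h : IsInwardFlow V ρ X φ) {q : CSpace n}
    (hq : q ∈ frontier V) {w : CSpace n} (h1 : fderiv ℝ (hitTime φ V) q w = 0)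
    (h2 : fderiv ℝ (hitTime φ V) q (Complex.I • w) = 0) : w ∈ complexTangent ρ q :=
  ⟨by rw [h.fderiv_hitTime hq, h1, mul_zero], by rw [h.fderiv_hitTime hq, h2, mul_zero]⟩

/-- On the complex tangent space, the Levi forms of two defining functions of a hypersurface are
proportional; here one of them is the hitting time. -/
theorem leviForm_hitTime (h : IsInwardFlow V ρ X φ) {q : CSpace n} (hq : q ∈ frontier V)
    {w : CSpace n} (h1 : fderiv ℝ (hitTime φ V) q w = 0)
    (h2 : fderiv ℝ (hitTime φ V) q (Complex.I • w) = 0) :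
    leviForm ρ q w = -fderiv ℝ ρ q (X q) * leviForm (hitTime φ V) q w := by
  obtain ⟨P, hP, hPq, hdP, hρP, hτP⟩ := h.exists_projection hq
  have hτ := h.contDiffAt_hitTime (h.mem_hitSet_of_frontier hq)
  have key : ∀ {f : CSpace n → ℝ}, ContDiffAt ℝ ∞ f q → (∀ᶠ y in 𝓝 q, f (P y) = 0) →
      ∀ v, fderiv ℝ (hitTime φ V) q v = 0 →
        fderiv ℝ (fderiv ℝ f) q v v = -fderiv ℝ f q (fderiv ℝ (fderiv ℝ P) q v v) := by
    intro f hf hfP v hv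
    have e1 := fderiv_fderiv_comp (f := f) (h := P) (z := q) (by rwa [hPq]) hP v v
    have e2 : (fun y => f (P y)) =ᶠ[𝓝 q] fun _ => (0 : ℝ) := hfP
    have e3 : fderiv ℝ (fderiv ℝ fun _ : CSpace n => (0 : ℝ)) q = 0 := by
      have : fderiv ℝ (fun _ : CSpace n => (0 : ℝ)) = fun _ => 0 := by
        ext1 y
        simp
      rw [this]
      simp
    rw [e2.fderiv.fderiv_eq, e3, hPq, hdP, hv, zero_smul, add_zero] at e1
    simp only [zero_apply] at e1
    linarith
  unfold leviForm
  rw [key h.isDefiningFunction.contDiff.contDiffAt hρP w h1,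
    key h.isDefiningFunction.contDiff.contDiffAt hρP _ h2, key hτ hτP w h1, key hτ hτP _ h2,
    h.fderiv_hitTime hq (fderiv ℝ (fderiv ℝ P) q w w), h.fderiv_hitTime hq
      (fderiv ℝ (fderiv ℝ P) q (Complex.I • w) (Complex.I • w))]
  ring

/-- For large `l`, the function `exp (l τ)` of the hitting time `τ` is strictly plurisubharmonic
along a strictly pseudoconvex compact boundary. -/
theorem exists_leviForm_exp_pos (h : IsInwardFlow V ρ X φ) (hc : IsCompact (frontier V))
    (hlevi : ∀ z ∈ frontier V, ∀ w ∈ complexTangent ρ z, w ≠ 0 → 0 < leviForm ρ z w) :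
    ∃ l : ℝ, 0 < l ∧ ∀ z ∈ frontier V, ∀ w, w ≠ 0 →
      0 < leviForm (fun y => Real.exp (l * hitTime φ V y)) z w := by
  set τ := hitTime φ V with hτdef
  have hsub : frontier V ⊆ hitSet φ V := fun z hz => h.mem_hitSet_of_frontier hz
  have hd : ContDiffOn ℝ ∞ (fderiv ℝ τ) (hitSet φ V) :=
    h.contDiffOn_hitTime.fderiv_of_isOpen h.isOpen_hitSet (by simp)
  have hdd : ContDiffOn ℝ ∞ (fderiv ℝ (fderiv ℝ τ)) (hitSet φ V) :=
    hd.fderiv_of_isOpen h.isOpen_hitSet (by simp)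
  set K : Set (CSpace n × CSpace n) := frontier V ×ˢ Metric.sphere 0 1 with hK
  have hfst : MapsTo Prod.fst K (hitSet φ V) := fun x hx => hsub hx.1
  have hd' : ContinuousOn (fun x : CSpace n × CSpace n => fderiv ℝ τ x.1) K :=
    hd.continuousOn.comp continuousOn_fst hfst
  have hdd' : ContinuousOn (fun x : CSpace n × CSpace n => fderiv ℝ (fderiv ℝ τ) x.1) K :=
    hdd.continuousOn.comp continuousOn_fst hfst
  have hI : ContinuousOn (fun x : CSpace n × CSpace n => Complex.I • x.2) K := by fun_prop
  obtain ⟨l, hl, hpos⟩ := exists_mul_add_pos (K := K) (hc.prod (isCompact_sphere 0 1))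
    (a := fun x => fderiv ℝ τ x.1 x.2 ^ 2 + fderiv ℝ τ x.1 (Complex.I • x.2) ^ 2)
    (b := fun x => 4 * leviForm τ x.1 x.2)
    (((hd'.clm_apply continuousOn_snd).pow 2).add ((hd'.clm_apply hI).pow 2))
    (continuousOn_const.mul (((((hdd'.clm_apply continuousOn_snd).clm_apply continuousOn_snd)).add
      ((hdd'.clm_apply hI).clm_apply hI)).div_const 4))
    (fun x _ => by positivity)
    (fun x hx hx0 => by
      have e1 : fderiv ℝ τ x.1 x.2 = 0 := by
        nlinarith [sq_nonneg (fderiv ℝ τ x.1 x.2), sq_nonneg (fderiv ℝ τ x.1 (Complex.I • x.2))]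
      have e2 : fderiv ℝ τ x.1 (Complex.I • x.2) = 0 := by
        nlinarith [sq_nonneg (fderiv ℝ τ x.1 x.2), sq_nonneg (fderiv ℝ τ x.1 (Complex.I • x.2))]
      have hne : x.2 ≠ 0 := by
        intro h0
        have := hx.2
        rw [h0] at this
        simp at this
      have h3 := hlevi x.1 hx.1 x.2 (h.mem_complexTangent_hitTime hx.1 e1 e2) hne
      rw [h.leviForm_hitTime hx.1 e1 e2] at h3
      have h4 := h.pointsInward x.1 hx.1
      have := (mul_pos_iff_of_pos_left (neg_pos.2 h4)).1 h3
      positivity)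
  refine ⟨l, hl, fun z hz w hw => ?_⟩
  have hnorm : 0 < ‖w‖ := norm_pos_iff.2 hw
  have hw' : w = ‖w‖ • (‖w‖⁻¹ • w) := by
    rw [smul_smul, mul_inv_cancel₀ hnorm.ne', one_smul]
  rw [hw', leviForm_smul, leviForm_exp_mul (h.contDiffAt_hitTime (hsub hz))]
  have hp := hpos (z, ‖w‖⁻¹ • w) ⟨hz, by simp [norm_smul, hnorm.ne']⟩
  have : 0 < l * Real.exp (l * τ z) / 4 := by positivity
  exact mul_pos (by positivity) (mul_pos this hp)

/-- Strict plurisubharmonicity of `exp (l τ)` is carried along the flow, because `exp (l τ)` is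
multiplied by a constant and the flow is holomorphic where the field is. -/
theorem leviForm_exp_pos (h : IsInwardFlow V ρ X φ) {O : Set (CSpace n)} (hO : IsOpen O)
    (hXO : DifferentiableOn ℂ X O) {l : ℝ}
    (hl : ∀ z ∈ frontier V, ∀ w, w ≠ 0 →
      0 < leviForm (fun y => Real.exp (l * hitTime φ V y)) z w)
    {z : CSpace n} (hz : z ∈ hitSet φ V)
    (hseg : ∀ s ∈ Icc (0 : ℝ) 1, φ (s * hitTime φ V z) z ∈ O) {w : CSpace n} (hw : w ≠ 0) :
    0 < leviForm (fun y => Real.exp (l * hitTime φ V y)) z w := by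
  set T := hitTime φ V z with hT
  have hfr : φ T z ∈ frontier V := flow_hitTime_mem hz
  have hsm : ContDiffAt ℝ ∞ (fun y => Real.exp (l * hitTime φ V y)) (φ T z) :=
    (contDiffAt_const.mul (h.contDiffAt_hitTime (h.mem_hitSet_of_frontier hfr))).exp
  have hhol : ∀ᶠ y in 𝓝 z, ∀ w,
      fderiv ℝ (φ T) y (Complex.I • w) = Complex.I • fderiv ℝ (φ T) y w :=
    (h.isSmoothFlow.eventually_segment_mem hO hseg).mono fun y hy w =>
      h.isSmoothFlow.fderiv_I_smul h.contDiff hO hXO hy w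
  have heq : (fun y => Real.exp (l * hitTime φ V y)) =ᶠ[𝓝 z]
      fun y => Real.exp (l * T) * Real.exp (l * hitTime φ V (φ T y)) := by
    filter_upwards [(h.eventually_hitTime hz).1] with y hy
    rw [h.hitTime_flow hy, ← Real.exp_add]
    congr 1
    ring
  have hsmc : ContDiffAt ℝ ∞ (fun y => Real.exp (l * hitTime φ V (φ T y))) z :=
    hsm.comp z (h.isSmoothFlow.contDiff_slice T).contDiffAt
  rw [leviForm_congr heq, leviForm_const_mul hsmc,
    leviForm_comp (f := fun y => Real.exp (l * hitTime φ V y)) hsm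
      (h.isSmoothFlow.contDiff_slice T).contDiffAt hhol]
  refine mul_pos (Real.exp_pos _) (hl _ hfr _ fun h0 => hw ?_)
  have h1 := h.isSmoothFlow.fderiv_comp_fderiv_neg (-T) z w
  rw [neg_neg] at h1
  rw [← h1, h0, map_zero]

end IsInwardFlow

end Psh

/-! ### The region between the two boundaries -/

section Region

variable {n : ℕ} {V V₁ V₂ : Set (CSpace n)} {ρ ρ₁ ρ₂ : CSpace n → ℝ} {X : CSpace n → CSpace n}
  {φ : ℝ → CSpace n → CSpace n}

/-- An orbit that meets both a set and its complement meets the frontier. -/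
theorem mem_hitSet_of_mem_of_notMem (hφ : IsSmoothFlow X φ) {z : CSpace n} {s t : ℝ}
    (hs : φ s z ∈ V) (ht : φ t z ∉ V) : z ∈ hitSet φ V := by
  have h1 : (frontier ((fun t => φ t z) ⁻¹' V)).Nonempty :=
    nonempty_frontier_iff.2 ⟨⟨s, hs⟩, fun h => ht (by
      have : t ∈ (fun t => φ t z) ⁻¹' V := h ▸ mem_univ t
      exact this)⟩
  obtain ⟨r, hr⟩ := h1
  exact ⟨r, (hφ.continuous_orbit z).frontier_preimage_subset V hr⟩

/-- If every orbit from a compact set enters `V`, then all of them are in `V` at a common time. -/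
theorem IsInwardFlow.exists_uniform_time (h : IsInwardFlow V ρ X φ) {K : Set (CSpace n)}
    (hK : IsCompact K) (henter : ∀ z ∈ K, ∃ t, φ t z ∈ V) : ∃ T, ∀ z ∈ K, φ T z ∈ V := by
  have hmono : ∀ {s t : ℝ} {z}, s ≤ t → φ s z ∈ V → φ t z ∈ V := by
    intro s t z hst hs
    rcases hst.eq_or_lt with rfl | hlt
    · exact hs
    have := h.flow_mem (subset_closure hs) (sub_pos.2 hlt)
    rwa [← h.isSmoothFlow.add, sub_add_cancel] at this
  obtain ⟨T, hT⟩ := hK.elim_directed_cover (fun t : ℝ => φ t ⁻¹' V)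
    (fun t => h.isDefiningFunction.isOpen.preimage (h.isSmoothFlow.continuous_slice t))
    (fun z hz => mem_iUnion.2 (henter z hz))
    (directed_of_isDirected_le fun s t hst z hz => hmono hst hz)
  exact ⟨T, hT⟩

theorem Contactomorphic.congr {S₁ S₂ : Set (CSpace n)} {ξ₁ ξ₁' ξ₂ ξ₂' : CSpace n → Set (CSpace n)}
    (h : Contactomorphic S₁ ξ₁ S₂ ξ₂) (h₁ : ∀ z ∈ S₁, ξ₁ z = ξ₁' z) (h₂ : ∀ z ∈ S₂, ξ₂ z = ξ₂' z) :
    Contactomorphic S₁ ξ₁' S₂ ξ₂' := by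
  obtain ⟨Φ, Ψ, hΦ, hΨ, hm, hm', hl, hr, hξ⟩ := h
  refine ⟨Φ, Ψ, hΦ, hΨ, hm, hm', hl, hr, fun z hz => ?_⟩
  rw [← h₁ z hz, ← h₂ _ (hm hz), hξ z hz]

/-- The complex tangent space of the boundary is that of the level set of `exp (l τ)`. -/
theorem IsInwardFlow.complexTangent_exp (h : IsInwardFlow V ρ X φ) {l : ℝ} (hl : 0 < l)
    {z : CSpace n} (hz : z ∈ frontier V) :
    complexTangent (fun y => Real.exp (l * hitTime φ V y)) z = complexTangent ρ z := by
  have hd := (h.contDiffAt_hitTime (h.mem_hitSet_of_frontier hz)).differentiableAt (by simp)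
  have hX := (h.pointsInward z hz).ne
  have hl' : l * Real.exp (l * hitTime φ V z) ≠ 0 := (mul_pos hl (Real.exp_pos _)).ne'
  ext w
  change (_ = _ ∧ _ = _) ↔ (fderiv ℝ ρ z w = 0 ∧ fderiv ℝ ρ z (Complex.I • w) = 0)
  rw [fderiv_exp_mul hd, h.fderiv_hitTime hz w, h.fderiv_hitTime hz (Complex.I • w)]
  simp only [smul_apply, smul_eq_mul, mul_eq_zero, hl', neg_eq_zero, hX, false_or]

theorem IsInwardFlow.setOf_exp_hitTime_eq_one (h : IsInwardFlow V ρ X φ) {l : ℝ} (hl : 0 < l)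
    {N : Set (CSpace n)} (hN : N ⊆ hitSet φ V) (hfr : frontier V ⊆ N) :
    {z ∈ N | Real.exp (l * hitTime φ V z) = 1} = frontier V := by
  ext z
  constructor
  · rintro ⟨hz, h1⟩
    have h2 : hitTime φ V z = 0 := by
      rw [Real.exp_eq_one_iff, mul_eq_zero] at h1
      exact h1.resolve_left hl.ne'
    have h3 := flow_hitTime_mem (hN hz)
    rwa [h2, h.isSmoothFlow.zero] at h3
  · intro hz
    exact ⟨hfr hz, by simp [h.hitTime_of_frontier hz]⟩

/-- The heart of the argument, for a complete flow that is holomorphic on `V₁`: the functions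
`exp (l τ)` of the two hitting times interpolate between the two boundaries. -/
theorem contactomorphic_of_isInwardFlow (hV₁ : IsStrictlyPseudoconvexDomain V₁ ρ₁)
    (hV₂ : IsStrictlyPseudoconvexDomain V₂ ρ₂) (hV : closure V₂ ⊆ V₁)
    (h₁ : IsInwardFlow V₁ ρ₁ X φ) (h₂ : IsInwardFlow V₂ ρ₂ X φ) {O : Set (CSpace n)}
    (hO : IsOpen O) (hVO : closure V₁ ⊆ O) (hXO : DifferentiableOn ℂ X O)
    (henter : ∀ z ∈ closure V₁, ∃ t, φ t z ∈ V₂) :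
    Contactomorphic (frontier V₁) (complexTangent ρ₁) (frontier V₂) (complexTangent ρ₂) := by
  have hφ := h₁.isSmoothFlow
  have hcl₁ : IsCompact (closure V₁) := hV₁.isBounded.isCompact_closure
  have hfr₁ : IsCompact (frontier V₁) :=
    hcl₁.of_isClosed_subset isClosed_frontier frontier_subset_closure
  have hfr₂ : IsCompact (frontier V₂) :=
    hV₂.isBounded.isCompact_closure.of_isClosed_subset isClosed_frontier frontier_subset_closure
  set K : Set (CSpace n) := closure V₁ \ V₂ with hK
  have hKc : IsCompact K := hcl₁.diff hV₂.isOpen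
  obtain ⟨T, hT⟩ := h₂.exists_uniform_time hcl₁ henter
  set N : Set (CSpace n) := hitSet φ V₁ ∩ hitSet φ V₂ with hN
  have hNo : IsOpen N := h₁.isOpen_hitSet.inter h₂.isOpen_hitSet
  have hKN : K ⊆ N := by
    rintro z ⟨hz₁, hz₂⟩
    constructor
    -- if `φ_{-T}(z)` were still in `V₁`, then `z = φ_T(φ_{-T}(z))` would be in `V₂`
    · refine mem_hitSet_of_mem_of_notMem hφ (h₁.flow_mem hz₁ one_pos) (t := -T) fun hmem => hz₂ ?_
      have := hT _ (subset_closure hmem)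
      rwa [hφ.apply_neg] at this
    · refine mem_hitSet_of_mem_of_notMem hφ (hT z hz₁) (t := 0) ?_
      rwa [hφ.zero]
  have hfrK₁ : frontier V₁ ⊆ K := fun z hz =>
    ⟨frontier_subset_closure hz, fun h => h₁.notMem_of_mem_frontier hz (hV (subset_closure h))⟩
  have hfrK₂ : frontier V₂ ⊆ K := fun z hz =>
    ⟨subset_closure (hV (frontier_subset_closure hz)), h₂.notMem_of_mem_frontier hz⟩
  -- orbits reach the outer boundary before the inner one
  have hτ_le : ∀ z ∈ N, hitTime φ V₁ z ≤ hitTime φ V₂ z := fun z hz =>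
    h₁.le_of_mem_frontier (subset_closure (hV (frontier_subset_closure (flow_hitTime_mem hz.2))))
      (flow_hitTime_mem hz.1)
  obtain ⟨l₁, hl₁, hpos₁⟩ := h₁.exists_leviForm_exp_pos hfr₁ hV₁.levi_pos
  obtain ⟨l₂, hl₂, hpos₂⟩ := h₂.exists_leviForm_exp_pos hfr₂ hV₂.levi_pos
  set F₁ : CSpace n → ℝ := fun y => Real.exp (l₁ * hitTime φ V₁ y) with hF₁
  set F₂ : CSpace n → ℝ := fun y => Real.exp (l₂ * hitTime φ V₂ y) with hF₂
  have hF₁s : ContDiffOn ℝ ∞ F₁ N :=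
    (contDiffOn_const.mul (h₁.contDiffOn_hitTime.mono inter_subset_left)).exp
  have hF₂s : ContDiffOn ℝ ∞ F₂ N :=
    (contDiffOn_const.mul (h₂.contDiffOn_hitTime.mono inter_subset_right)).exp
  have htrack : ∀ q ∈ levelTrack F₁ F₂ N, q.2 ∈ K := by
    rintro q ⟨⟨hs0, hs1⟩, hqN, hq⟩
    have hq' : (1 - q.1) * F₁ q.2 + q.1 * F₂ q.2 = 1 := hq
    have hle := hτ_le q.2 hqN
    constructor
    · by_contra hnot
      have p1 := h₁.hitTime_pos hqN.1 hnot
      have e1 : 1 < F₁ q.2 := Real.one_lt_exp_iff.2 (mul_pos hl₁ p1)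
      have e2 : 1 < F₂ q.2 := Real.one_lt_exp_iff.2 (mul_pos hl₂ (p1.trans_le hle))
      exact absurd hq' (ne_of_gt (convex_Ioi (1 : ℝ) e1 e2 (sub_nonneg.2 hs1) hs0
        (sub_add_cancel _ _)))
    · intro hmem
      have p2 := h₂.hitTime_neg hqN.2 hmem
      have e1 : F₁ q.2 < 1 :=
        Real.exp_lt_one_iff.2 (mul_neg_of_pos_of_neg hl₁ (hle.trans_lt p2))
      have e2 : F₂ q.2 < 1 := Real.exp_lt_one_iff.2 (mul_neg_of_pos_of_neg hl₂ p2)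
      exact absurd hq' (ne_of_lt (convex_Iio (1 : ℝ) e1 e2 (sub_nonneg.2 hs1) hs0
        (sub_add_cancel _ _)))
  have hC : IsCompact (levelTrack F₁ F₂ N) := by
    have heq : levelTrack F₁ F₂ N = (Icc (0 : ℝ) 1 ×ˢ K) ∩ pencil F₁ F₂ ⁻¹' {1} := by
      ext q
      exact ⟨fun hq => ⟨⟨hq.1, htrack q hq⟩, hq.2.2⟩, fun hq => ⟨hq.1.1, hKN hq.1.2, hq.2⟩⟩
    rw [heq]
    have hIK : IsCompact (Icc (0 : ℝ) 1 ×ˢ K) := isCompact_Icc.prod hKc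
    refine hIK.of_isClosed_subset ?_ inter_subset_left
    exact ((contDiffOn_pencil hF₁s hF₂s).continuousOn.mono
      (prod_mono (subset_univ _) hKN)).preimage_isClosed_of_isClosed hIK.isClosed
      isClosed_singleton
  have hseg₂ : ∀ z ∈ K, ∀ s ∈ Icc (0 : ℝ) 1, φ (s * hitTime φ V₂ z) z ∈ O := by
    intro z hz s hs
    have h0 : 0 ≤ hitTime φ V₂ z := by
      by_contra! hlt
      have h3 := h₂.flow_mem (frontier_subset_closure (flow_hitTime_mem (hKN hz).2))
        (neg_pos.2 hlt)
      rw [hφ.neg_apply] at h3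
      exact hz.2 h3
    exact hVO (h₁.flow_mem_closure hz.1 (mul_nonneg hs.1 h0))
  have hseg₁ : ∀ z ∈ K, ∀ s ∈ Icc (0 : ℝ) 1, φ (s * hitTime φ V₁ z) z ∈ O := by
    intro z hz s hs
    have h0 : hitTime φ V₁ z ≤ 0 :=
      h₁.le_of_mem_frontier (by rw [hφ.zero]; exact hz.1) (flow_hitTime_mem (hKN hz).1)
    have h3 := h₁.flow_mem_closure (frontier_subset_closure (flow_hitTime_mem (hKN hz).1))
      (t := (s - 1) * hitTime φ V₁ z)
      (mul_nonneg_of_nonpos_of_nonpos (sub_nonpos.2 hs.2) h0)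
    rw [← hφ.add, show (s - 1) * hitTime φ V₁ z + hitTime φ V₁ z = s * hitTime φ V₁ z by ring] at h3
    exact hVO h3
  have hgray := contactomorphic_levelSets hNo hF₁s hF₂s hC
    (fun q hq w hw =>
      ⟨h₁.leviForm_exp_pos hO hXO hpos₁ (hKN (htrack q hq)).1 (hseg₁ _ (htrack q hq)) hw,
        h₂.leviForm_exp_pos hO hXO hpos₂ (hKN (htrack q hq)).2 (hseg₂ _ (htrack q hq)) hw⟩)
    (fun q hq => by
      obtain ⟨hq1, hq2⟩ := hKN (htrack q hq)
      refine ⟨X q.2, ?_, ?_⟩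
      · rw [fderiv_exp_mul ((h₁.contDiffAt_hitTime hq1).differentiableAt (by simp)), smul_apply,
          h₁.fderiv_hitTime_field hq1, smul_eq_mul, mul_neg_one, neg_lt_zero]
        exact mul_pos hl₁ (Real.exp_pos _)
      · rw [fderiv_exp_mul ((h₂.contDiffAt_hitTime hq2).differentiableAt (by simp)), smul_apply,
          h₂.fderiv_hitTime_field hq2, smul_eq_mul, mul_neg_one, neg_lt_zero]
        exact mul_pos hl₂ (Real.exp_pos _))
  rw [h₁.setOf_exp_hitTime_eq_one hl₁ inter_subset_left (hfrK₁.trans hKN),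
    h₂.setOf_exp_hitTime_eq_one hl₂ inter_subset_right (hfrK₂.trans hKN)] at hgray
  exact hgray.congr (fun z hz => h₁.complexTangent_exp hl₁ hz)
    fun z hz => h₂.complexTangent_exp hl₂ hz

end Region

theorem proposition11 (n : ℕ) (V₁ V₂ U : Set (CSpace n)) (ρ₁ ρ₂ : CSpace n → ℝ)
    (hV₁ : IsStrictlyPseudoconvexDomain V₁ ρ₁) (hV₂ : IsStrictlyPseudoconvexDomain V₂ ρ₂)
    (hV : closure V₂ ⊆ V₁)
    (hU : IsOpen U) (hVU : closure V₁ ⊆ U)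
    (X : CSpace n → CSpace n) (hX : DifferentiableOn ℂ X U)
    (hin₁ : PointsInward X V₁ ρ₁) (hin₂ : PointsInward X V₂ ρ₂)
    (p : CSpace n) (hp : p ∈ V₂) (hzero : ∀ z ∈ V₂, X z = 0 ↔ z = p)
    (hflow : FlowRetracts X U V₁ p) :
    Contactomorphic (frontier V₁) (complexTangent ρ₁) (frontier V₂) (complexTangent ρ₂) := by
  -- a compactly supported field has a complete flow; only its values near `closure V₁` matter
  obtain ⟨W, O, hW, hWc, hO, hVO, hOU, hWX⟩ := exists_compactlySupported_eqOn hU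
    hV₁.isBounded.isCompact_closure hVU
    ((contDiffOn_of_differentiableOn_complex hU hX).restrict_scalars ℝ)
  obtain ⟨φ, hφ⟩ := exists_isSmoothFlow hW hWc
  have hWO : DifferentiableOn ℂ W O := (hX.mono hOU).congr hWX
  have h₁ : IsInwardFlow V₁ ρ₁ W φ := ⟨hV₁.isDefiningFunction, hW, hφ, fun z hz => by
    rw [hWX (hVO (frontier_subset_closure hz))]
    exact hin₁ z hz⟩
  have h₂ : IsInwardFlow V₂ ρ₂ W φ := ⟨hV₂.isDefiningFunction, hW, hφ, fun z hz => by
    rw [hWX (hVO (subset_closure (hV (frontier_subset_closure hz))))]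
    exact hin₂ z hz⟩
  obtain ⟨L, hL⟩ := hW.lipschitzWith_of_hasCompactSupport hWc (by simp)
  -- from `V₁` the orbits of `W` are the given integral curves of `X`, hence enter `V₂`
  have henter : ∀ z ∈ V₁, ∃ t, φ t z ∈ V₂ := by
    intro z hz
    obtain ⟨γ, hγ0, hγ, hlim⟩ := hflow z hz
    have hmem : ∀ t ∈ Ici (0 : ℝ), γ t ∈ V₁ := by
      intro t ht
      rcases (mem_Ici.1 ht).eq_or_lt with rfl | hlt
      · rwa [hγ0]
      · exact hV₁.isDefiningFunction.integralCurve_mem hin₁ (fun t ht => (hγ t ht).2)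
          (by rw [hγ0]; exact subset_closure hz) hlt
    obtain ⟨t, htV, ht0⟩ :=
      ((hlim.eventually (hV₂.isOpen.mem_nhds hp)).and (eventually_ge_atTop 0)).exists
    have heq : EqOn γ (fun t => φ t z) (Icc 0 t) := by
      refine ODE_solution_unique (v := fun _ => W) (K := L) (fun _ => hL)
        (fun s hs => ((hγ s hs.1).2.continuousWithinAt).mono fun r hr => hr.1)
        (fun s hs => ?_) (hφ.continuous_orbit z).continuousOn
        (fun s _ => (hφ.hasDerivAt s z).hasDerivWithinAt) (by simp [hγ0, hφ.zero])
      rw [hWX (hVO (subset_closure (hmem s hs.1)))]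
      exact (hγ s hs.1).2.mono fun r hr => le_trans hs.1 hr
    have ht : γ t = φ t z := heq ⟨ht0, le_rfl⟩
    exact ⟨t, ht ▸ htV⟩
  refine contactomorphic_of_isInwardFlow hV₁ hV₂ hV h₁ h₂ hO hVO hWO fun z hz => ?_
  obtain ⟨t, ht⟩ := henter _ (h₁.flow_mem hz one_pos)
  exact ⟨t + 1, by rwa [hφ.add]⟩
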